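/- Fix integers $n\ge 2$ and $\ell\ge 1$; colours are residues $i$ modulo $n$. **Abacus.** A configuration $\psi$ consists of $\ell$ rows (numbered $0,\dots,\ell-1$ from bottom to top) of beads at positions in $\mathbb Z+\tfrac12$, each row having finitely many empty negative and finitely many full positive positions. Let $\psi_j^k$ be the position of the $k$-th bead from the right on row $j$, and extend to $j\in\mathbb Z$ by $\psi_{j+\ell}^k=\psi_j^k-n$. The configuration is *descending* if $\psi_{j+1}^k\le\psi_j^k$ for all $j\in\mathbb Z$, $k\ge1$. A descending configuration is *tight* if for no $k$ can the $k$-th beads all be shifted down one row, i.e. for no $k$ does $\psi_{j+1}^k>\psi_j^{k+1}$ hold for all $j\in\mathbb Z$. The *compactification* of $\psi$ is obtained by pushing all beads to the left within their rows by finitely many moves; a configuration is *compact* if it has no empty position to the left of a bead. The gap at $g\in\mathbb Z$ between the positions $g\mp\frac12$ has colour $g \bmod n$. For a colour $i$ write, gap by gap from left to right and within a gap from bottom to top, a "(" for each bead that can move right and a ")" for each bead that can move left across a gap of colour $i$, and cancel matching pairs "( )". Then $f_i$ moves the bead of the leftmost uncancelled "(" one step to the right, $e_i$ moves the bead of the rightmost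 uncancelled ")" one step to the left, and they give $0$ if there is no such bracket. **Kyoto path model.** Let $B_\ell=B^{1,\ell}$ be the set of weakly increasing words of length $\ell$ in the letters $\frac12,\frac32,\dots,n-\frac12$; $f_i$ changes one letter $i-\frac12$ to $i+\frac12$ (for $i=0$: one $n-\frac12$ to $\frac12$) and reorders, $e_i$ is the reverse, and they give $0$ if the required letter does not occur. In any of these crystals $\varepsilon_i(b)=\max\{m:e_i^m b\ne0\}$, $\varphi_i(b)=\max\{m:f_i^m b\neq0\}$, $\varepsilon(b)=\sum_i\varepsilon_i(b)\Lambda_i$ and $\varphi(b)=\sum_i\varphi_i(b)\Lambda_i$, where the $\Lambda_i$ are the fundamental weights of $\widehat{\mathfrak{sl}}_n$. The tensor product rule is: $e_i(a\otimes b)=e_ia\otimes b$ if $\varphi_i(a)\ge\varepsilon_i(b)$ and $a\otimes e_ib$ otherwise; $f_i(a\otimes b)=f_ia\otimes b$ if $\varphi_i(a)>\varepsilon_i(b)$ and $a\otimes f_ib$ otherwise. On paths $\cdots\otimes p_3\otimes p_2\otimes p_1$ with $p_k\in B_\ell$ it induces operators $e_i,f_i$: a path $p$ is sent to $q$ if,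 for all large $N$, $p_N\otimes\cdots\otimes p_1$ is sent to $q_N\otimes\cdots\otimes q_1$, and to $0$ if there is no such $q$. A ground state path of weight $\Lambda$ is a path $b$ with $\varphi(b_1)=\Lambda$ and $\varepsilon(b_k)=\varphi(b_{k+1})$ for all $k\ge1$. $P_{n,\ell}(\Lambda)$ is the set of paths that differ from the ground state path of weight $\Lambda$ in only finitely many places. **Theorem.** Let $\psi_{(0)}$ be a compact descending configuration and let $\Lambda(\psi_{(0)})=\sum_i m_i\Lambda_i$, where $m_i$ is the number of rows $0\le j\le\ell-1$ of $\psi_{(0)}$ whose rightmost bead is at a position congruent to $i-\frac12$ modulo $n$. Let $B$ be the set of tight descending configurations with compactification $\psi_{(0)}$. For a configuration $\psi$ let $\overline{\psi^k}\in B_\ell$ be the word with letters $\psi_0^k,\dots,\psi_{\ell-1}^k$ reduced modulo $n$, and put $J(\psi)=\cdots\otimes\overline{\psi^3}\otimes\overline{\psi^2}\otimes\overline{\psi^1}$. Then $J$ restricts to a crystal isomorphism from $B$ onto $P_{n,\ell}(\Lambda(\psi_{(0)}))$. That is: both sets (together with $0$) are closed under all $e_i$ and $f_i$; $J:B\to P_{n,\ell}(\Lambda(\psi_{(0)}))$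 is a bijection; $e_iJ(\psi)=J(e_i\psi)$ and $f_iJ(\psi)=J(f_i\psi)$ for all $\psi\in B$ and all $i$ (with $J(0)=0$), and so $\varepsilon_i(J(\psi))=\varepsilon_i(\psi)$ and $\varphi_i(J(\psi))=\varphi_i(\psi)$. Moreover $\psi_{(0)}\in B$, and $J(\psi_{(0)})$ is the unique ground state path of weight $\Lambda(\psi_{(0)})$. In particular, for every $n\ge2$ (including $n=2$), the coloured directed graph on $B$ with an edge of colour $i$ from $\psi$ to $f_i\psi$ whenever $f_i\psi\ne0$ is isomorphic to that of the Kyoto path model $P_{n,\ell}(\Lambda(\psi_{(0)}))$ of the irreducible highest weight crystal of weight $\Lambda(\psi_{(0)})$. -/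

import Mathlib

open Set Filter

/-! ### Crystals: sets with operators `e i`, `f i`, and tensor products -/

/-- The crystal operators on a set `B`, indexed by a set `I` of colours.
The value `none` plays the role of the symbol `0`. -/
structure CrystalOps (I : Type*) (B : Type*) where
  e : I → B → Option B
  f : I → B → Option B

namespace CrystalOps

universe u

variable {I A : Type*} {B : Type u}

/-- `iter g m b` is the `m`-fold application of the partial map `g` to `b`
(`none` as soon as one of the steps gives `none`). -/
def iter (g : B → Option B) : ℕ → B → Option B
  | 0, b => some b
  | m + 1, b => (g b).bind (iter g m)

/-- `ε_i(b) = max {m : e_i^m(b) ≠ 0}`. -/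
noncomputable def eps (C : CrystalOps I B) (i : I) (b : B) : ℕ :=
  sSup {m : ℕ | iter (C.e i) m b ≠ none}

/-- `φ_i(b) = max {m : f_i^m(b) ≠ 0}`. -/
noncomputable def phi (C : CrystalOps I B) (i : I) (b : B) : ℕ :=
  sSup {m : ℕ | iter (C.f i) m b ≠ none}

/-- The one-element crystal on which all operators vanish; it is the empty tensor product. -/
def unit (I : Type*) : CrystalOps I PUnit.{u + 1} where
  e _ _ := none
  f _ _ := none

/-- The tensor product rule: `(a, b)` stands for `a ⊗ b`. -/
noncomputable def tensor (C : CrystalOps I A) (D : CrystalOps I B) : CrystalOps I (A × B) where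
  e i x :=
    if D.eps i x.2 ≤ C.phi i x.1 then (C.e i x.1).map (fun a => (a, x.2))
    else (D.e i x.2).map (fun b => (x.1, b))
  f i x :=
    if D.eps i x.2 < C.phi i x.1 then (C.f i x.1).map (fun a => (a, x.2))
    else (D.f i x.2).map (fun b => (x.1, b))

/-- The underlying set of `B ⊗ (B ⊗ (⋯ ⊗ B))` with `N` factors. -/
def Power (B : Type u) : ℕ → Type u
  | 0 => PUnit
  | N + 1 => B × Power B N

/-- The crystal `B ⊗ ⋯ ⊗ B` with `N` factors. -/
noncomputable def power (C : CrystalOps I B) : (N : ℕ) → CrystalOps I (Power B N)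
  | 0 => unit I
  | N + 1 => C.tensor (power C N)

/-- A path `⋯ ⊗ p_3 ⊗ p_2 ⊗ p_1` is a map `p : ℕ → B`; the factor `p_{k+1}` is `p k`.
`trunc p N` consists of its `N` rightmost factors `p_N ⊗ ⋯ ⊗ p_1`. -/
def trunc (p : ℕ → B) : (N : ℕ) → Power B N
  | 0 => PUnit.unit
  | N + 1 => (p N, trunc p N)

open Classical in
/-- Given operators on all finite tensor powers, the induced operator on infinite paths:
`p` is sent to `q` if, for all sufficiently large `N`, the `N` rightmost factors of `p` are sent
to the `N` rightmost factors of `q`, and to `0` if there is no such `q`.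
Such a `q` is unique. -/
noncomputable def stable (g : (N : ℕ) → Power B N → Option (Power B N)) (p : ℕ → B) :
    Option (ℕ → B) :=
  if h : ∃ q : ℕ → B, ∀ᶠ N in atTop, g N (trunc p N) = some (trunc q N) then some h.choose
  else none

/-- The operators given by the tensor product rule on the paths in `⋯ ⊗ B ⊗ B ⊗ B`. -/
noncomputable def paths (C : CrystalOps I B) : CrystalOps I (ℕ → B) where
  e i := stable (fun N => (C.power N).e i)
  f i := stable (fun N => (C.power N).f i)

/-- `p` is a ground state path of weight `∑ i, lam i • Λ_i`, that is,
`φ(p_1) = lam` and `ε(p_k) = φ(p_{k+1})` for all `k ≥ 1`.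
Here `φ(b) = ∑ i, φ_i(b) Λ_i` and `ε(b) = ∑ i, ε_i(b) Λ_i`; such weights are given by their
coefficients. -/
def IsGroundStatePath (C : CrystalOps I B) (lam : I → ℕ) (p : ℕ → B) : Prop :=
  (∀ i, C.phi i (p 0) = lam i) ∧ ∀ k i, C.eps i (p k) = C.phi i (p (k + 1))

/-- The path model of weight `lam`: all paths which differ from the ground state path of weight
`lam` in only finitely many places. -/
def pathModel (C : CrystalOps I B) (lam : I → ℕ) : Set (ℕ → B) :=
  {p | ∃ g, C.IsGroundStatePath lam g ∧ {k | p k ≠ g k}.Finite}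

/-- `S` and `T` are closed under the crystal operators, and `F` restricts to a bijection
`S → T` which commutes with all operators (including where these are `0`). -/
structure IsIsoOn (C : CrystalOps I A) (D : CrystalOps I B) (S : Set A) (T : Set B)
    (F : A → B) : Prop where
  closed_e : ∀ i, ∀ a ∈ S, ∀ a', C.e i a = some a' → a' ∈ S
  closed_f : ∀ i, ∀ a ∈ S, ∀ a', C.f i a = some a' → a' ∈ S
  closed_e' : ∀ i, ∀ b ∈ T, ∀ b', D.e i b = some b' → b' ∈ T
  closed_f' : ∀ i, ∀ b ∈ T, ∀ b', D.f i b = some b' → b' ∈ T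
  bijOn : BijOn F S T
  map_e : ∀ i, ∀ a ∈ S, D.e i (F a) = (C.e i a).map F
  map_f : ∀ i, ∀ a ∈ S, D.f i (F a) = (C.f i a).map F

end CrystalOps

/-! ### The perfect crystal of level `ℓ` -/

/-- The perfect crystal `B^{1,ℓ}`. The colours are the residues modulo `n`.
The letter `a + 1/2`, for `a = 0, …, n - 1`, is represented by the residue of `a`, and a one-row
semistandard filling, being weakly increasing, by the multiset of its `ℓ` entries.
`f i` replaces one entry `i - 1/2` by `i + 1/2` (for `i = 0`: one entry `n - 1/2` by `1/2`),
`e i` does the reverse. -/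
def perfectCrystal (n ℓ : ℕ) : CrystalOps (ZMod n) (Sym (ZMod n) ℓ) where
  e i b :=
    if h : i ∈ b.1 then
      some ⟨(i - 1) ::ₘ b.1.erase i, by
        rw [Multiset.card_cons, Multiset.card_erase_add_one h]; exact b.2⟩
    else none
  f i b :=
    if h : i - 1 ∈ b.1 then
      some ⟨i ::ₘ b.1.erase (i - 1), by
        rw [Multiset.card_cons, Multiset.card_erase_add_one h]; exact b.2⟩
    else none

/-- The Kyoto path crystal: all paths in `⋯ ⊗ B^{1,ℓ} ⊗ B^{1,ℓ}` with the operators given by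
the tensor product rule. -/
noncomputable def kyotoCrystal (n ℓ : ℕ) : CrystalOps (ZMod n) (ℕ → Sym (ZMod n) ℓ) :=
  (perfectCrystal n ℓ).paths

/-- The set `P_{n,ℓ}(lam)`. -/
def kyotoPaths (n ℓ : ℕ) (lam : ZMod n → ℕ) : Set (ℕ → Sym (ZMod n) ℓ) :=
  (perfectCrystal n ℓ).pathModel lam

/-! ### The abacus -/

/-- A row of beads at positions in `ℤ + 1/2`, with finitely many empty negative positions and
finitely many full positive positions. The bead at position `x + 1/2` is recorded as the
integer `x`, and `bead k` is the `(k+1)`-st bead counted from the right.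
The finiteness condition says that far to the left there are no gaps. -/
structure BeadRow where
  bead : ℕ → ℤ
  strictAnti : StrictAnti bead
  eventually_full : ∃ c : ℤ, ∀ᶠ k : ℕ in atTop, bead k = c - k

namespace BeadRow

/-- The gap `g` is the one between positions `g - 1/2` and `g + 1/2`.
A bead can move to the right across it if `g - 1/2` is occupied and `g + 1/2` is empty. -/
def CanMoveRight (r : BeadRow) (g : ℤ) : Prop := g - 1 ∈ range r.bead ∧ g ∉ range r.bead

/-- A bead can move to the left across the gap `g` if `g + 1/2` is occupied and
`g - 1/2` is empty. -/
def CanMoveLeft (r : BeadRow) (g : ℤ) : Prop := g ∈ range r.bead ∧ g - 1 ∉ range r.bead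

theorem eventually_lt (r : BeadRow) (x : ℤ) : ∀ᶠ k : ℕ in atTop, r.bead k < x := by
  obtain ⟨c, hc⟩ := r.eventually_full
  filter_upwards [hc, eventually_gt_atTop (c - x).toNat] with k hk hk'
  omega

open Classical in
/-- Move the bead at `g - 1/2` to `g + 1/2` (if this is possible). -/
noncomputable def moveRight (r : BeadRow) (g : ℤ) : BeadRow :=
  if h : r.CanMoveRight g then
    { bead := fun k => if r.bead k = g - 1 then g else r.bead k
      strictAnti := by
        intro a b hab
        have h1 := r.strictAnti hab
        have h2 : r.bead a ≠ g := fun h' => h.2 ⟨a, h'⟩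
        dsimp only
        split_ifs <;> omega
      eventually_full := by
        obtain ⟨c, hc⟩ := r.eventually_full
        refine ⟨c, ?_⟩
        filter_upwards [hc, r.eventually_lt (g - 1)] with k hk hk'
        rw [if_neg (by omega), hk] }
  else r

open Classical in
/-- Move the bead at `g + 1/2` to `g - 1/2` (if this is possible). -/
noncomputable def moveLeft (r : BeadRow) (g : ℤ) : BeadRow :=
  if h : r.CanMoveLeft g then
    { bead := fun k => if r.bead k = g then g - 1 else r.bead k
      strictAnti := by
        intro a b hab
        have h1 := r.strictAnti hab
        have h2 : r.bead b ≠ g - 1 := fun h' => h.2 ⟨b, h'⟩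
        dsimp only
        split_ifs <;> omega
      eventually_full := by
        obtain ⟨c, hc⟩ := r.eventually_full
        refine ⟨c, ?_⟩
        filter_upwards [hc, r.eventually_lt (g - 1)] with k hk hk'
        rw [if_neg (by omega), hk] }
  else r

end BeadRow

section Brackets

variable {α : Type*} [LinearOrder α]

/-- In a string of brackets, with opening brackets at the places in `O` and closing brackets at
the places in `C`, matching pairs (an opening bracket followed by a closing one) cancel.
The opening bracket at `x` remains uncanceled if and only if no segment of the string that starts
directly after `x` has more closing than opening brackets. -/
def uncanceledOpen (O C : Set α) : Set α :=
  {x | x ∈ O ∧ ∀ y, (C ∩ Ioc x y).ncard ≤ (O ∩ Ioc x y).ncard}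

/-- The closing bracket at `x` remains uncanceled if and only if no segment of the string that
ends directly before `x` has more opening than closing brackets. -/
def uncanceledClose (O C : Set α) : Set α :=
  {x | x ∈ C ∧ ∀ y, (O ∩ Ico y x).ncard ≤ (C ∩ Ico y x).ncard}

end Brackets

/-- A configuration of beads on an abacus with `ℓ` rows, row `0` being the bottom one. -/
abbrev Abacus (ℓ : ℕ) : Type := Fin ℓ → BeadRow

namespace Abacus

variable {ℓ : ℕ}

/-- The places of the brackets: the bracket above the gap `g` belonging to the row `j`.
They are read gap by gap from left to right and, within a gap, from the bottom row to the top row;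
this is the lexicographic order. -/
abbrev Place (ℓ : ℕ) : Type := ℤ ×ₗ Fin ℓ

/-- The opening brackets for the colour `i`; the gap `g` has the colour `g` modulo `n`. -/
def opens {n : ℕ} (ψ : Abacus ℓ) (i : ZMod n) : Set (Place ℓ) :=
  {p | ((ofLex p).1 : ZMod n) = i ∧ (ψ (ofLex p).2).CanMoveRight (ofLex p).1}

/-- The closing brackets for the colour `i`. -/
def closes {n : ℕ} (ψ : Abacus ℓ) (i : ZMod n) : Set (Place ℓ) :=
  {p | ((ofLex p).1 : ZMod n) = i ∧ (ψ (ofLex p).2).CanMoveLeft (ofLex p).1}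

open Classical in
/-- `f i` moves the bead of the first uncanceled opening bracket from the left one position to
the right, and `e i` moves the bead of the first uncanceled closing bracket from the right one
position to the left; they give `0` if there is no such bracket. -/
noncomputable def crystal (n ℓ : ℕ) : CrystalOps (ZMod n) (Abacus ℓ) where
  e i ψ :=
    if h : ∃ p, IsGreatest (uncanceledClose (ψ.opens i) (ψ.closes i)) p then
      some (Function.update ψ (ofLex h.choose).2
        ((ψ (ofLex h.choose).2).moveLeft (ofLex h.choose).1))
    else none
  f i ψ :=
    if h : ∃ p, IsLeast (uncanceledOpen (ψ.opens i) (ψ.closes i)) p then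
      some (Function.update ψ (ofLex h.choose).2
        ((ψ (ofLex h.choose).2).moveRight (ofLex h.choose).1))
    else none

/-- Rows indexed by all integers: row `i + ℓ` is row `i` shifted `n` steps to the left.
`ψ.ext n i k` is the position of the `(k+1)`-st bead from the right on row `i`. -/
def ext [NeZero ℓ] (n : ℕ) (ψ : Abacus ℓ) (i : ℤ) (k : ℕ) : ℤ :=
  (ψ ⟨(i % ℓ).toNat, by
    have h : (0 : ℤ) < ℓ := by exact_mod_cast NeZero.pos ℓ
    have h1 := Int.emod_nonneg i h.ne'
    have h2 := Int.emod_lt_of_pos i h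
    omega⟩).bead k - n * (i / ℓ)

/-- `ψ_0 ≥ ψ_1 ≥ ⋯ ≥ ψ_{ℓ-1} ≥ ψ_ℓ`, where rows are compared bead by bead. -/
def IsDescending [NeZero ℓ] (n : ℕ) (ψ : Abacus ℓ) : Prop :=
  ∀ (i : ℤ) (k : ℕ), ψ.ext n (i + 1) k ≤ ψ.ext n i k

/-- The condition under which the tightening operator `T_{k+1}`, which shifts the `(k+1)`-st bead
on each row down one row, is non-zero at `ψ`: after the shift, the `(k+1)`-st bead of each row is
still strictly to the right of the `(k+2)`-nd bead. -/
def CanTighten [NeZero ℓ] (n : ℕ) (ψ : Abacus ℓ) (k : ℕ) : Prop :=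
  ∀ i : ℤ, ψ.ext n i (k + 1) < ψ.ext n (i + 1) k

/-- A (descending) configuration is tight if all tightening operators vanish at it. -/
def IsTight [NeZero ℓ] (n : ℕ) (ψ : Abacus ℓ) : Prop :=
  ∀ k, ¬ ψ.CanTighten n k

/-- All beads are pushed to the left: no row has an empty position to the left of a bead. -/
def IsCompact (ψ : Abacus ℓ) : Prop :=
  ∀ j k, (ψ j).bead (k + 1) = (ψ j).bead k - 1

/-- `ψ₀` is the compactification of `ψ`: it is compact and is obtained from `ψ` by moving only
finitely many beads, each within its row. -/
def IsCompactification (ψ ψ₀ : Abacus ℓ) : Prop :=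
  ψ₀.IsCompact ∧ ∀ j, ∀ᶠ k in atTop, (ψ j).bead k = (ψ₀ j).bead k

/-- The weight `Λ(ψ₀) = ∑ i, m_i Λ_i`, given by its coefficients: `m_i` is the number of rows
whose last (rightmost) bead is in position `i - 1/2` modulo `n`. -/
def weight (n : ℕ) (ψ₀ : Abacus ℓ) (i : ZMod n) : ℕ :=
  (Finset.univ.filter fun j : Fin ℓ => (((ψ₀ j).bead 0 : ℤ) : ZMod n) = i - 1).card

/-- The tight descending configurations with compactification `ψ₀`. -/
def tightDescending [NeZero ℓ] (n : ℕ) (ψ₀ : Abacus ℓ) : Set (Abacus ℓ) :=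
  {ψ | ψ.IsDescending n ∧ ψ.IsTight n ∧ ψ.IsCompactification ψ₀}

/-- The path `⋯ ⊗ ψ̄^3 ⊗ ψ̄^2 ⊗ ψ̄^1`: the entries of the factor `ψ̄^k` are the positions modulo
`n` of the `k`-th beads from the right on the `ℓ` rows. -/
def toPath (n : ℕ) (ψ : Abacus ℓ) : ℕ → Sym (ZMod n) ℓ := fun k =>
  ⟨(Finset.univ : Finset (Fin ℓ)).val.map fun j => (((ψ j).bead k : ℤ) : ZMod n), by simp⟩

end Abacus

/-! Fix a colour and an integer `g` representing it. In the periodic extension all gaps of that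
colour become the single gap `g`, seen on rows `J : ℤ`, and the reading order of the brackets
becomes the order of `J`. Since the `k`-th beads descend with `J`, those at `g` occupy an interval
`[A k, B k)` of rows and those at `g - 1` the adjacent interval `[B k, C k)`. The lengths of these
intervals are the multiplicities of two letters in the `k`-th factor, hence its `ε` and `φ`. Rows
where both positions are occupied carry no bracket, but they contribute to the two interval counts
with opposite signs, so nothing is lost.

Let `height J` be the number of opening minus closing brackets from `J` to the right. The bracket
moved by `f` sits at the rightmost maximum of the height, the one moved by `e` just before the
leftmost maximum, and both maxima occur at points `B k`. On the path side, `E k = ε(p_k ⊗ ⋯ ⊗ p_1)`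
satisfies the recursion `E (k + 1) = ε k + (E k - φ k)`, with truncated subtraction, while the
height at `B k` has increments `φ (k + 1) - ε k`. Hence `E k - φ k` is the largest height difference
from an earlier `B m` to `B k`, for every positive index `k`. So the factor chosen by the tensor
product rule is the last strict record (for `f`) or the last weak record (for `e`) of the heights,
that is, the first or last maximum. Both models therefore change the same bead: `IsHeight`,
`BracketStrands.isLeast_uncanceledOpen` and `BracketStrands.isGreatest_uncanceledClose` carry this,
and `IsDescending.f_spec` and `IsDescending.e_spec` combine it. Maximality of the height also shows
that the moves preserve tightness.

For bijectivity, the residues of the `k`-th beads determine their strand up to a shift along the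
rows. Being strictly to the right of the next strand bounds the shift on one side, and tightness
makes it extremal, so exactly one choice remains. Starting in the common compact tail, every path is
thus lifted uniquely, one strand at a time (`IsStrand.eq_of_residues_eq`, `IsStrand.exists_lift`).
-/

namespace CrystalOps

universe u

/-! ### String lengths, tensor powers and operators on infinite paths. -/

variable {I A : Type*} {B : Type u}

theorem iter_ne_none_iff {g : B → Option B} {ε : B → ℕ} (h0 : ∀ b, g b = none ↔ ε b = 0)
    (h1 : ∀ b b', g b = some b' → ε b = ε b' + 1) (m : ℕ) (b : B) :
    iter g m b ≠ none ↔ m ≤ ε b := by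
  induction m generalizing b with
  | zero => simp [iter]
  | succ m ih =>
    rw [iter]
    cases hb : g b with
    | none => simp [(h0 b).1 hb]
    | some b' => rw [Option.bind_some, ih, h1 b b' hb]; omega

/-- Makes string lengths computable: a candidate only has to vanish where `g` stops and to drop by
one at each step. -/
theorem sSup_iter_eq {g : B → Option B} {ε : B → ℕ} (h0 : ∀ b, g b = none ↔ ε b = 0)
    (h1 : ∀ b b', g b = some b' → ε b = ε b' + 1) (b : B) :
    sSup {m : ℕ | iter g m b ≠ none} = ε b := by
  have : {m : ℕ | iter g m b ≠ none} = Iic (ε b) := by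
    ext m; exact iter_ne_none_iff h0 h1 m b
  rw [this, csSup_Iic]

/-- The string lengths `ε_i` detect and count applications of `e_i`. -/
def IsLowerNormal (C : CrystalOps I B) (i : I) : Prop :=
  (∀ b, C.e i b = none ↔ C.eps i b = 0) ∧ ∀ b b', C.e i b = some b' → C.eps i b = C.eps i b' + 1

theorem isLowerNormal_of_eq {C : CrystalOps I B} {i : I} {ε : B → ℕ}
    (h0 : ∀ b, C.e i b = none ↔ ε b = 0) (h1 : ∀ b b', C.e i b = some b' → ε b = ε b' + 1) :
    C.IsLowerNormal i ∧ ∀ b, C.eps i b = ε b := by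
  have h : ∀ b, C.eps i b = ε b := fun b => sSup_iter_eq h0 h1 b
  exact ⟨⟨fun b => by rw [h, h0], fun b b' hb => by rw [h, h, h1 b b' hb]⟩, h⟩

/-- The rule spends `e i` on the right factor until its `ε` has come down to `φ` of the left factor,
then on the left factor, whose `φ` only grows. Only `ε` of the right factor enters, so `φ` of a
tensor power is never needed. -/
theorem isLowerNormal_tensor {C : CrystalOps I A} {D : CrystalOps I B} {i : I}
    (hC : C.IsLowerNormal i) (hφ : ∀ a a', C.e i a = some a' → C.phi i a' = C.phi i a + 1)
    (hD : D.IsLowerNormal i) :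
    (C.tensor D).IsLowerNormal i ∧
      ∀ x, (C.tensor D).eps i x = C.eps i x.1 + (D.eps i x.2 - C.phi i x.1) := by
  apply isLowerNormal_of_eq
  · rintro ⟨a, b⟩
    have h1 := hC.1 a
    have h2 := hD.1 b
    simp only [tensor]
    split_ifs with h
    · rw [Option.map_eq_none_iff, h1]; omega
    · rw [Option.map_eq_none_iff, h2]; omega
  · rintro ⟨a, b⟩ x'
    simp only [tensor]
    split_ifs with h
    · rw [Option.map_eq_some_iff]
      rintro ⟨a', ha, rfl⟩
      have h1 := hC.2 a a' ha
      have h2 := hφ a a' ha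
      dsimp only
      omega
    · rw [Option.map_eq_some_iff]
      rintro ⟨b', hb, rfl⟩
      have h1 := hD.2 b b' hb
      dsimp only
      omega

theorem eps_unit (i : I) (x : PUnit.{u + 1}) : (unit.{u} I).eps i x = 0 :=
  (isLowerNormal_of_eq (C := unit.{u} I) (i := i) (ε := fun _ => 0) (by simp [unit])
    (by simp [unit])).2 x

theorem isLowerNormal_unit (i : I) : (unit.{u} I).IsLowerNormal i :=
  (isLowerNormal_of_eq (ε := fun _ => 0) (by simp [unit]) (by simp [unit])).1

theorem isLowerNormal_power {C : CrystalOps I B} {i : I} (hC : C.IsLowerNormal i)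
    (hφ : ∀ a a', C.e i a = some a' → C.phi i a' = C.phi i a + 1) (N : ℕ) :
    (C.power N).IsLowerNormal i := by
  induction N with
  | zero => exact isLowerNormal_unit i
  | succ N ih => exact (isLowerNormal_tensor hC hφ ih).1

theorem eps_power_succ {C : CrystalOps I B} {i : I} (hC : C.IsLowerNormal i)
    (hφ : ∀ a a', C.e i a = some a' → C.phi i a' = C.phi i a + 1) (p : ℕ → B) (N : ℕ) :
    (C.power (N + 1)).eps i (trunc p (N + 1)) =
      C.eps i (p N) + ((C.power N).eps i (trunc p N) - C.phi i (p N)) :=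
  (isLowerNormal_tensor hC hφ (isLowerNormal_power hC hφ N)).2 _

theorem eps_power_zero (C : CrystalOps I B) (i : I) (p : ℕ → B) :
    (C.power 0).eps i (trunc p 0) = 0 := eps_unit i _

theorem trunc_eq_iff {p q : ℕ → B} {N : ℕ} : trunc p N = trunc q N ↔ ∀ k < N, p k = q k := by
  induction N with
  | zero => exact ⟨fun _ k hk => absurd hk k.not_lt_zero, fun _ => rfl⟩
  | succ N ih =>
    have : trunc p (N + 1) = trunc q (N + 1) ↔ p N = q N ∧ trunc p N = trunc q N := by
      simp only [trunc]; exact Prod.mk_inj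
    rw [this, ih, Nat.forall_lt_succ_right, and_comm]

theorem trunc_update_of_le (p : ℕ → B) {k N : ℕ} (h : N ≤ k) (b : B) :
    trunc (Function.update p k b) N = trunc p N :=
  trunc_eq_iff.2 fun m hm => Function.update_of_ne (by omega) _ _

/-- Two candidates agree on arbitrarily long truncations, so the choice in `stable` is harmless. -/
theorem stable_eq_some {g : (N : ℕ) → Power B N → Option (Power B N)} {p q : ℕ → B}
    (h : ∀ᶠ N in atTop, g N (trunc p N) = some (trunc q N)) : stable g p = some q := by
  have hex : ∃ q : ℕ → B, ∀ᶠ N in atTop, g N (trunc p N) = some (trunc q N) := ⟨q, h⟩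
  rw [stable, dif_pos hex]
  congr 1
  funext k
  obtain ⟨N, ⟨h1, h2⟩, hN⟩ := ((hex.choose_spec.and h).and (eventually_gt_atTop k)).exists
  rw [h1, Option.some_inj] at h2
  exact trunc_eq_iff.1 h2 k hN

theorem trunc_update_succ (p : ℕ → B) (k : ℕ) (b : B) :
    trunc (Function.update p k b) (k + 1) = (b, trunc p k) := by
  rw [trunc, Function.update_self, trunc_update_of_le p le_rfl]

theorem trunc_update_succ_of_lt (p : ℕ → B) {k N : ℕ} (h : k < N) (b : B) :
    trunc (Function.update p k b) (N + 1) = (p N, trunc (Function.update p k b) N) := by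
  rw [trunc, Function.update_of_ne h.ne']

/-- A family of operators on finite tensor powers acts on the factor with index `N` of
`trunc p (N + 1)` by `g` if `P N` holds, and on the factors to its right otherwise. -/
structure ActsBy (op : (N : ℕ) → Power B N → Option (Power B N)) (g : B → Option B)
    (p : ℕ → B) (P : ℕ → Prop) : Prop where
  zero : op 0 (trunc p 0) = none
  of_pos : ∀ N, P N → op (N + 1) (trunc p (N + 1)) = (g (p N)).map fun a => (a, trunc p N)
  of_neg : ∀ N, ¬ P N →
    op (N + 1) (trunc p (N + 1)) = (op N (trunc p N)).map fun b => (p N, b)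

section ActsBy

variable {op : (N : ℕ) → Power B N → Option (Power B N)} {g : B → Option B} {p : ℕ → B}
  {P : ℕ → Prop}

/-- The outermost factor satisfying `P` takes the action; factors further left pass it on unchanged.
-/
theorem ActsBy.stable_of_last (h : ActsBy op g p P) {k : ℕ} (hk : P k) (hlast : ∀ m > k, ¬ P m)
    {b : B} (hb : g (p k) = some b) : stable op p = some (Function.update p k b) := by
  apply stable_eq_some
  filter_upwards [eventually_ge_atTop (k + 1)] with N hN
  induction N, hN using Nat.le_induction with
  | base => rw [h.of_pos k hk, hb, trunc_update_succ]; rfl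
  | succ N hN ih =>
    rw [h.of_neg N (hlast N (by omega)), ih, trunc_update_succ_of_lt p (by omega)]
    rfl

theorem ActsBy.stable_of_never (h : ActsBy op g p P) (hP : ∀ m, ¬ P m) : stable op p = none := by
  have h0 : ∀ N, op N (trunc p N) = none := by
    intro N
    induction N with
    | zero => exact h.zero
    | succ N ih => rw [h.of_neg N (hP N), ih]; rfl
  rw [stable, dif_neg]
  rintro ⟨q, hq⟩
  obtain ⟨N, hN⟩ := hq.exists
  simp [h0] at hN

/-- The action escapes to the left: one truncation would force `q m` to be the image of `p m`, a
longer one would force `q m = p m`. This is how `e i` can vanish on an infinite path although it is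
nonzero on truncations. -/
theorem ActsBy.stable_of_frequently (h : ActsBy op g p P) (hP : ∃ᶠ m in atTop, P m)
    (hg : ∀ b, g b ≠ some b) : stable op p = none := by
  rw [stable, dif_neg]
  rintro ⟨q, hq⟩
  obtain ⟨M, hM⟩ := eventually_atTop.1 hq
  have key : ∀ m ≥ M, P m → g (p m) = some (q m) ∧ ∀ r < m, p r = q r := by
    intro m hm hPm
    have h1 := hM (m + 1) (by omega)
    rw [h.of_pos m hPm] at h1
    obtain ⟨a, ha, h2⟩ := Option.map_eq_some_iff.1 h1
    have h3 : a = q m ∧ trunc p m = trunc q m := Prod.mk_inj.1 h2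
    exact ⟨h3.1 ▸ ha, trunc_eq_iff.1 h3.2⟩
  obtain ⟨m, hm, hPm⟩ := frequently_atTop.1 hP M
  obtain ⟨m', hm', hPm'⟩ := frequently_atTop.1 hP (m + 1)
  have h1 := (key m hm hPm).1
  rw [← (key m' (by omega) hPm').2 m (by omega)] at h1
  exact hg _ h1

end ActsBy

theorem actsBy_f (C : CrystalOps I B) (i : I) (p : ℕ → B) :
    ActsBy (fun N => (C.power N).f i) (C.f i) p
      fun k => (C.power k).eps i (trunc p k) < C.phi i (p k) where
  zero := rfl
  of_pos _ h := if_pos h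
  of_neg _ h := if_neg h

theorem actsBy_e (C : CrystalOps I B) (i : I) (p : ℕ → B) :
    ActsBy (fun N => (C.power N).e i) (C.e i) p
      fun k => (C.power k).eps i (trunc p k) ≤ C.phi i (p k) where
  zero := rfl
  of_pos _ h := if_pos h
  of_neg _ h := if_neg h

theorem iter_map {g : A → Option A} {g' : B → Option B} {S : Set A} {F : A → B}
    (hS : ∀ a ∈ S, ∀ a', g a = some a' → a' ∈ S) (hF : ∀ a ∈ S, g' (F a) = (g a).map F)
    (m : ℕ) {a : A} (ha : a ∈ S) : iter g' m (F a) = (iter g m a).map F := by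
  induction m generalizing a with
  | zero => rfl
  | succ m ih =>
    simp only [iter, hF a ha]
    cases h : g a with
    | none => rfl
    | some a' => exact ih (hS a ha a' h)

namespace IsIsoOn

variable {C : CrystalOps I A} {D : CrystalOps I B} {S : Set A} {T : Set B} {F : A → B}

theorem eps_eq (h : IsIsoOn C D S T F) (i : I) {a : A} (ha : a ∈ S) :
    D.eps i (F a) = C.eps i a := by
  simp only [eps, iter_map (h.closed_e i) (h.map_e i) _ ha, ne_eq, Option.map_eq_none_iff]

theorem phi_eq (h : IsIsoOn C D S T F) (i : I) {a : A} (ha : a ∈ S) :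
    D.phi i (F a) = C.phi i a := by
  simp only [phi, iter_map (h.closed_f i) (h.map_f i) _ ha, ne_eq, Option.map_eq_none_iff]

theorem of_bijOn (closed_e : ∀ i, ∀ a ∈ S, ∀ a', C.e i a = some a' → a' ∈ S)
    (closed_f : ∀ i, ∀ a ∈ S, ∀ a', C.f i a = some a' → a' ∈ S) (bijOn : BijOn F S T)
    (map_e : ∀ i, ∀ a ∈ S, D.e i (F a) = (C.e i a).map F)
    (map_f : ∀ i, ∀ a ∈ S, D.f i (F a) = (C.f i a).map F) : IsIsoOn C D S T F where
  closed_e := closed_e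
  closed_f := closed_f
  closed_e' i b hb b' h := by
    obtain ⟨a, ha, rfl⟩ := bijOn.surjOn hb
    rw [map_e i a ha, Option.map_eq_some_iff] at h
    obtain ⟨a', h', rfl⟩ := h
    exact bijOn.mapsTo (closed_e i a ha a' h')
  closed_f' i b hb b' h := by
    obtain ⟨a, ha, rfl⟩ := bijOn.surjOn hb
    rw [map_f i a ha, Option.map_eq_some_iff] at h
    obtain ⟨a', h', rfl⟩ := h
    exact bijOn.mapsTo (closed_f i a ha a' h')
  bijOn := bijOn
  map_e := map_e
  map_f := map_f

end IsIsoOn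

end CrystalOps

/-! ### String lengths in the perfect crystal are letter multiplicities. -/

section PerfectCrystal

open CrystalOps

variable {n ℓ : ℕ}

/-- The two letters exchanged by `e i` and `f i` are distinct, so each step changes their
multiplicities by exactly one; `n = 2` needs no separate treatment. -/
theorem ZMod.sub_one_ne_self (hn : 2 ≤ n) (i : ZMod n) : i - 1 ≠ i := by
  have : Fact (1 < n) := ⟨by omega⟩
  intro h
  exact one_ne_zero (sub_eq_self.1 h)

theorem perfectCrystal_e_eq_some {i : ZMod n} {b b' : Sym (ZMod n) ℓ}
    (h : (perfectCrystal n ℓ).e i b = some b') :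
    i ∈ b.1 ∧ b'.1 = (i - 1) ::ₘ b.1.erase i := by
  simp only [perfectCrystal] at h
  split_ifs at h with hi
  exact ⟨hi, by rw [← Option.some.inj h]⟩

theorem perfectCrystal_f_eq_some {i : ZMod n} {b b' : Sym (ZMod n) ℓ}
    (h : (perfectCrystal n ℓ).f i b = some b') :
    i - 1 ∈ b.1 ∧ b'.1 = i ::ₘ b.1.erase (i - 1) := by
  simp only [perfectCrystal] at h
  split_ifs at h with hi
  exact ⟨hi, by rw [← Option.some.inj h]⟩

theorem perfectCrystal_e_of_mem {i : ZMod n} {b b' : Sym (ZMod n) ℓ} (h : i ∈ b.1)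
    (h' : b'.1 = (i - 1) ::ₘ b.1.erase i) : (perfectCrystal n ℓ).e i b = some b' :=
  (dif_pos h).trans (congrArg some (Subtype.ext h'.symm))

theorem perfectCrystal_f_of_mem {i : ZMod n} {b b' : Sym (ZMod n) ℓ} (h : i - 1 ∈ b.1)
    (h' : b'.1 = i ::ₘ b.1.erase (i - 1)) : (perfectCrystal n ℓ).f i b = some b' :=
  (dif_pos h).trans (congrArg some (Subtype.ext h'.symm))

theorem perfectCrystal_isLowerNormal (hn : 2 ≤ n) (i : ZMod n) :
    (perfectCrystal n ℓ).IsLowerNormal i ∧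
      ∀ b, (perfectCrystal n ℓ).eps i b = Multiset.count i b.1 := by
  have hi := ZMod.sub_one_ne_self hn i
  apply isLowerNormal_of_eq
  · intro b
    simp only [perfectCrystal, Multiset.count_eq_zero]
    split_ifs with h <;> simpa using h
  · intro b b' h
    obtain ⟨h1, h2⟩ := perfectCrystal_e_eq_some h
    have := Multiset.count_pos.2 h1
    rw [h2, Multiset.count_cons_of_ne hi.symm, Multiset.count_erase_self]
    omega

theorem perfectCrystal_phi (hn : 2 ≤ n) (i : ZMod n) (b : Sym (ZMod n) ℓ) :
    (perfectCrystal n ℓ).phi i b = Multiset.count (i - 1) b.1 := by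
  have hi := ZMod.sub_one_ne_self hn i
  refine sSup_iter_eq (g := (perfectCrystal n ℓ).f i)
    (ε := fun b : Sym (ZMod n) ℓ => Multiset.count (i - 1) b.1) ?_ ?_ b
  · intro b
    simp only [perfectCrystal, Multiset.count_eq_zero]
    split_ifs with h <;> simpa using h
  · intro b b' h
    obtain ⟨h1, h2⟩ := perfectCrystal_f_eq_some h
    have := Multiset.count_pos.2 h1
    rw [h2, Multiset.count_cons_of_ne hi, Multiset.count_erase_self]
    omega

theorem perfectCrystal_phi_e (hn : 2 ≤ n) (i : ZMod n) (b b' : Sym (ZMod n) ℓ)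
    (h : (perfectCrystal n ℓ).e i b = some b') :
    (perfectCrystal n ℓ).phi i b' = (perfectCrystal n ℓ).phi i b + 1 := by
  have hi := ZMod.sub_one_ne_self hn i
  rw [perfectCrystal_phi hn, perfectCrystal_phi hn, (perfectCrystal_e_eq_some h).2,
    Multiset.count_cons_self, Multiset.count_erase_of_ne hi]

theorem perfectCrystal_e_ne_self (hn : 2 ≤ n) (i : ZMod n) (b : Sym (ZMod n) ℓ) :
    (perfectCrystal n ℓ).e i b ≠ some b := by
  intro h
  have := perfectCrystal_phi_e hn i b b h
  omega

end PerfectCrystal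

/-! ### The tensor product rule as a search for records of a height function. -/

section Records

variable {φ ε E : ℕ → ℕ} {H : ℕ → ℤ}

/-- The recursion satisfied by `E k = ε(p_k ⊗ ⋯ ⊗ p_1)`, together with the height function `H`
whose increments compare the brackets of adjacent factors. -/
structure IsHeight (φ ε E : ℕ → ℕ) (H : ℕ → ℤ) : Prop where
  zero : E 0 = 0
  succ : ∀ k, E (k + 1) = ε k + (E k - φ k)
  height : ∀ k, H (k + 1) = H k + φ (k + 1) - ε k

namespace IsHeight

/-- Together with `exists_eq` this says that `E k - φ k` is the maximum of `H m - H k` over `m < k`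
when `k > 0`. The truncated subtraction in the recursion produces the maximum with the new term `m =
k`. -/
theorem sub_le (h : IsHeight φ ε E H) (k : ℕ) : ∀ m < k, H m - H k ≤ (E k : ℤ) - φ k := by
  induction k with
  | zero => simp
  | succ k ih =>
    intro m hm
    have h1 := h.succ k
    have h2 := h.height k
    rcases Nat.lt_succ_iff_lt_or_eq.1 hm with hm | rfl
    · have := ih m hm
      omega
    · omega

theorem exists_eq (h : IsHeight φ ε E H) (k : ℕ) :
    ∃ m < k + 1, H m - H (k + 1) = (E (k + 1) : ℤ) - φ (k + 1) := by
  induction k with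
  | zero => exact ⟨0, by omega, by have := h.succ 0; have := h.height 0; have := h.zero; omega⟩
  | succ k ih =>
    have h1 := h.succ (k + 1)
    have h2 := h.height (k + 1)
    by_cases hc : E (k + 1) ≤ φ (k + 1)
    · exact ⟨k + 1, by omega, by omega⟩
    · obtain ⟨m, hm, hm'⟩ := ih
      exact ⟨m, by omega, by omega⟩

/-- An index beyond `k` that is not a strict record is dominated by an earlier index, so strong
induction carries every value back to `k`. -/
theorem le_of_le (h : IsHeight φ ε E H) {k : ℕ} (hk : ∀ m > k, φ m ≤ E m)
    (hk' : ∀ m < k, H m ≤ H k) (m : ℕ) : H m ≤ H k := by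
  induction m using Nat.strong_induction_on with
  | _ m ih =>
    rcases lt_trichotomy m k with hm | rfl | hm
    · exact hk' m hm
    · rfl
    · obtain ⟨m, rfl⟩ : ∃ r, m = r + 1 := ⟨m - 1, by omega⟩
      obtain ⟨r, hr, hr'⟩ := h.exists_eq m
      have := ih r hr
      have := hk (m + 1) hm
      omega

theorem lt_of_lt (h : IsHeight φ ε E H) {k : ℕ} (hk : ∀ m > k, φ m < E m)
    (hk' : ∀ m < k, H m ≤ H k) {m : ℕ} (hm : k < m) : H m < H k := by
  obtain ⟨m, rfl⟩ : ∃ r, m = r + 1 := ⟨m - 1, by omega⟩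
  obtain ⟨r, hr, hr'⟩ := h.exists_eq m
  have := h.le_of_le (fun m hm => (hk m hm).le) hk' r
  have := hk (m + 1) hm
  omega

end IsHeight

end Records

/-! ### Cancellation of brackets arranged in adjacent intervals. -/

/-- Intervals `[A k, B k)` of closing and `[B k, C k)` of opening brackets at the integers, such
that the intervals of either kind follow each other from right to left. -/
structure BracketStrands (A B C : ℕ → ℤ) : Prop where
  A_le_B : ∀ k, A k ≤ B k
  B_le_C : ∀ k, B k ≤ C k
  B_succ_le_A : ∀ k, B (k + 1) ≤ A k
  C_succ_le_B : ∀ k, C (k + 1) ≤ B k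
  exists_le : ∀ J, ∃ k, B k ≤ J

namespace BracketStrands

variable {A B C : ℕ → ℤ}

/-- The opening brackets with no closing bracket at the same place. -/
def opening (A B C : ℕ → ℤ) : Set ℤ :=
  {J | (∃ k, B k ≤ J ∧ J < C k) ∧ ¬ ∃ k, A k ≤ J ∧ J < B k}

/-- The closing brackets with no opening bracket at the same place. -/
def closing (A B C : ℕ → ℤ) : Set ℤ :=
  {J | (∃ k, A k ≤ J ∧ J < B k) ∧ ¬ ∃ k, B k ≤ J ∧ J < C k}

theorem B_antitone (h : BracketStrands A B C) : Antitone B :=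
  antitone_nat_of_succ_le fun k => (h.B_succ_le_A k).trans (h.A_le_B k)

/-- Between consecutive points `B (k + 1)` and `B k` only strand `k + 1` can open and only strand
`k` can close, so the bracket pattern there depends on just two thresholds. -/
theorem mid_open (h : BracketStrands A B C) {k : ℕ} {J : ℤ} (h1 : B (k + 1) ≤ J) (h2 : J < B k) :
    (∃ m, B m ≤ J ∧ J < C m) ↔ J < C (k + 1) := by
  refine ⟨?_, fun h3 => ⟨k + 1, h1, h3⟩⟩
  rintro ⟨m, h3, h4⟩
  rcases lt_trichotomy m (k + 1) with hm | rfl | hm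
  · have := h.B_antitone (show m ≤ k by omega)
    omega
  · exact h4
  · obtain ⟨m, rfl⟩ : ∃ r, m = r + 1 := ⟨m - 1, by omega⟩
    have := h.B_antitone (show k + 1 ≤ m by omega)
    have := h.C_succ_le_B m
    omega

theorem mid_close (h : BracketStrands A B C) {k : ℕ} {J : ℤ} (h1 : B (k + 1) ≤ J) (h2 : J < B k) :
    (∃ m, A m ≤ J ∧ J < B m) ↔ A k ≤ J := by
  refine ⟨?_, fun h3 => ⟨k, h3, h2⟩⟩
  rintro ⟨m, h3, h4⟩
  rcases lt_trichotomy m k with hm | rfl | hm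
  · have := h.B_antitone (show m + 1 ≤ k by omega)
    have := h.B_succ_le_A m
    omega
  · exact h3
  · have := h.B_antitone (show k + 1 ≤ m by omega)
    omega

theorem top_open (h : BracketStrands A B C) {J : ℤ} (h1 : B 0 ≤ J) :
    (∃ m, B m ≤ J ∧ J < C m) ↔ J < C 0 := by
  refine ⟨?_, fun h3 => ⟨0, h1, h3⟩⟩
  rintro ⟨m, h3, h4⟩
  rcases m with _ | m
  · exact h4
  · have := h.B_antitone (Nat.zero_le m)
    have := h.C_succ_le_B m
    omega

theorem top_close (h : BracketStrands A B C) {J : ℤ} (h1 : B 0 ≤ J) :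
    ¬ ∃ m, A m ≤ J ∧ J < B m := by
  rintro ⟨m, h3, h4⟩
  have := h.B_antitone (Nat.zero_le m)
  omega

open Classical in
/-- The contribution of the place `J` to the number of opening minus closing brackets. -/
noncomputable def excess (A B C : ℕ → ℤ) (J : ℤ) : ℤ :=
  (if J ∈ opening A B C then 1 else 0) - (if J ∈ closing A B C then 1 else 0)

/-- The number of opening minus closing brackets at the places `J, J + 1, …`. -/
noncomputable def height (A B C : ℕ → ℤ) (J : ℤ) : ℤ :=
  ∑ x ∈ Finset.Ico J (C 0), excess A B C x

theorem excess_mid (h : BracketStrands A B C) {k : ℕ} {J : ℤ} (h1 : B (k + 1) ≤ J)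
    (h2 : J < B k) :
    excess A B C J = (if J < C (k + 1) then 1 else 0) - (if A k ≤ J then 1 else 0) := by
  simp only [excess, opening, closing, mem_ofPred_eq, h.mid_open h1 h2, h.mid_close h1 h2]
  split_ifs <;> first | rfl | (exfalso; tauto)

theorem excess_top (h : BracketStrands A B C) {J : ℤ} (h1 : B 0 ≤ J) :
    excess A B C J = if J < C 0 then 1 else 0 := by
  simp only [excess, opening, closing, mem_ofPred_eq, h.top_open h1, h.top_close h1]
  simp

theorem height_step (h : BracketStrands A B C) (J : ℤ) :
    height A B C J = excess A B C J + height A B C (J + 1) := by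
  unfold height
  rcases lt_or_ge J (C 0) with hJ | hJ
  · have : Finset.Ico J (C 0) = insert J (Finset.Ico (J + 1) (C 0)) := by
      ext x; simp only [Finset.mem_insert, Finset.mem_Ico]; omega
    rw [this, Finset.sum_insert (by simp)]
  · have := h.B_le_C 0
    rw [Finset.Ico_eq_empty (by omega), Finset.Ico_eq_empty (by omega), h.excess_top (by omega),
      if_neg (by omega)]
    simp

theorem height_top (h : BracketStrands A B C) {J : ℤ} (h1 : B 0 ≤ J) :
    height A B C J = max 0 (C 0 - J) := by
  rcases le_or_gt (C 0) J with hJ | hJ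
  · rw [height, Finset.Ico_eq_empty (by omega), Finset.sum_empty]; omega
  · have key : ∀ J ≤ C 0, B 0 ≤ J → height A B C J = C 0 - J := by
      intro J hJ
      induction J, hJ using Int.leInductionDown with
      | base => intro _; simp [height]
      | pred J hJ ih =>
        intro h2
        rw [h.height_step, h.excess_top h2, if_pos (by omega), sub_add_cancel, ih (by omega)]
        omega
    rw [key J hJ.le h1]; omega

/-- Walking left from `B k`, the height loses one per place down to `A k` and gains one per place
below `C (k + 1)`. Where the two ranges overlap both terms count and cancel, as the excess there is
zero. -/
theorem height_mid (h : BracketStrands A B C) (k : ℕ) {J : ℤ} (h1 : B (k + 1) ≤ J)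
    (h2 : J ≤ B k) :
    height A B C J = height A B C (B k) + max 0 (C (k + 1) - J) - min (B k - J) (B k - A k) := by
  have hC := h.C_succ_le_B k
  have hA := h.A_le_B k
  induction J, h2 using Int.leInductionDown with
  | base => omega
  | pred J hJ ih =>
    rw [h.height_step, h.excess_mid h1 (by omega), sub_add_cancel, ih (by omega)]
    split_ifs <;> omega

theorem height_B_succ (h : BracketStrands A B C) (k : ℕ) :
    height A B C (B (k + 1)) =
      height A B C (B k) + (C (k + 1) - B (k + 1)) - (B k - A k) := by
  have h1 := h.B_succ_le_A k
  have h2 := h.A_le_B k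
  have h3 := h.B_le_C (k + 1)
  rw [h.height_mid k le_rfl (by omega)]
  omega

theorem height_B_zero (h : BracketStrands A B C) : height A B C (B 0) = C 0 - B 0 := by
  have := h.B_le_C 0
  rw [h.height_top le_rfl]; omega

theorem exists_mid (h : BracketStrands A B C) {J : ℤ} (hJ : J < B 0) :
    ∃ k, B (k + 1) ≤ J ∧ J < B k := by
  classical
  have hex := h.exists_le J
  obtain ⟨k, hk⟩ : ∃ k, Nat.find hex = k + 1 := Nat.exists_eq_succ_of_ne_zero (by
    intro h0
    have := Nat.find_spec hex
    rw [h0] at this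
    omega)
  refine ⟨k, hk ▸ Nat.find_spec hex, ?_⟩
  have := Nat.find_min hex (m := k) (by omega)
  omega

/-- By `height_mid`, the height between neighbouring points `B` does not exceed the larger of the
two end values; hence only the values at these points matter for the maximum. -/
theorem exists_height_le (h : BracketStrands A B C) (J : ℤ) :
    ∃ k, height A B C J ≤ height A B C (B k) := by
  rcases le_or_gt (B 0) J with hJ | hJ
  · refine ⟨0, ?_⟩
    have := h.B_le_C 0
    rw [h.height_B_zero, h.height_top hJ]; omega
  · obtain ⟨k, h1, h2⟩ := h.exists_mid hJ
    have h3 := h.height_mid k h1 h2.le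
    have h4 := h.height_B_succ k
    have h5 := h.B_succ_le_A k
    have h6 := h.C_succ_le_B k
    have h7 := h.A_le_B k
    by_cases hc : height A B C J ≤ height A B C (B k)
    · exact ⟨k, hc⟩
    · exact ⟨k + 1, by omega⟩

theorem disjoint (J : ℤ) (h1 : J ∈ opening A B C) (h2 : J ∈ closing A B C) : False :=
  h2.2 h1.1

theorem excess_of_mem_opening {J : ℤ} (h : J ∈ opening A B C) : excess A B C J = 1 := by
  rw [excess, if_pos h, if_neg fun h' => disjoint J h h']; rfl

theorem excess_of_mem_closing {J : ℤ} (h : J ∈ closing A B C) : excess A B C J = -1 := by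
  rw [excess, if_pos h, if_neg fun h' => disjoint J h' h]; rfl

theorem ncard_Ico (h : BracketStrands A B C) {x y : ℤ} (hxy : x ≤ y) :
    ((opening A B C ∩ Ico x y).ncard : ℤ) - (closing A B C ∩ Ico x y).ncard =
      height A B C x - height A B C y := by
  induction y, hxy using Int.leInduction with
  | base => simp
  | succ y hxy ih =>
    have hstep := h.height_step y
    have key : ∀ S : Set ℤ, (y ∈ S → (S ∩ Ico x (y + 1)).ncard = (S ∩ Ico x y).ncard + 1) ∧
        (y ∉ S → (S ∩ Ico x (y + 1)).ncard = (S ∩ Ico x y).ncard) := by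
      intro S
      constructor
      · intro hy
        have : S ∩ Ico x (y + 1) = insert y (S ∩ Ico x y) := by
          ext z
          simp only [mem_inter_iff, mem_Ico, mem_insert_iff]
          constructor
          · rintro ⟨h1, h2, h3⟩
            by_cases hz : z = y
            · exact Or.inl hz
            · exact Or.inr ⟨h1, h2, by omega⟩
          · rintro (rfl | ⟨h1, h2, h3⟩)
            · exact ⟨hy, hxy, by omega⟩
            · exact ⟨h1, h2, by omega⟩
        rw [this, ncard_insert_of_notMem (by simp) ((finite_Ico x y).inter_of_right S)]
      · intro hy
        congr 1
        ext z
        simp only [mem_inter_iff, mem_Ico]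
        constructor
        · rintro ⟨h1, h2, h3⟩
          have hz : z ≠ y := by rintro rfl; exact hy h1
          exact ⟨h1, h2, by omega⟩
        · rintro ⟨h1, h2, h3⟩
          exact ⟨h1, h2, by omega⟩
    by_cases ho : y ∈ opening A B C
    · have hc : y ∉ closing A B C := fun hc => disjoint y ho hc
      rw [(key _).1 ho, (key _).2 hc]
      rw [excess_of_mem_opening ho] at hstep
      push_cast
      omega
    · by_cases hc : y ∈ closing A B C
      · rw [(key _).2 ho, (key _).1 hc]
        rw [excess_of_mem_closing hc] at hstep
        push_cast
        omega
      · rw [(key _).2 ho, (key _).2 hc]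
        rw [excess, if_neg ho, if_neg hc] at hstep
        omega

/-- The bracket condition says that the height at `x + 1` is at least every height to the right of
`x`; the opening bracket at `x` adds one more and makes this strict. -/
theorem mem_uncanceledOpen (h : BracketStrands A B C) {x : ℤ} :
    x ∈ uncanceledOpen (opening A B C) (closing A B C) ↔
      ∀ y > x, height A B C y < height A B C x := by
  have hIoc : ∀ y, Ioc x y = Ico (x + 1) (y + 1) := fun y => by ext z; simp
  constructor
  · rintro ⟨hx, hy⟩ y hxy
    have h1 := hy (y - 1)
    have h2 := h.ncard_Ico (show x + 1 ≤ y by omega)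
    rw [hIoc, sub_add_cancel] at h1
    have h3 := h.height_step x
    rw [excess_of_mem_opening hx] at h3
    omega
  · intro hx
    have h3 := h.height_step x
    have h4 := hx (x + 1) (by omega)
    have h5 : x ∈ opening A B C := by
      by_contra h5
      rw [excess, if_neg h5] at h3
      split_ifs at h3 <;> omega
    rw [excess_of_mem_opening h5] at h3
    refine ⟨h5, fun y => ?_⟩
    rcases le_or_gt y x with hy | hy
    · simp [Ioc_eq_empty (not_lt.2 hy)]
    · have h6 := h.ncard_Ico (show x + 1 ≤ y + 1 by omega)
      have h7 := hx (y + 1) (by omega)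
      rw [hIoc]
      omega

theorem mem_uncanceledClose (h : BracketStrands A B C) {x : ℤ} :
    x ∈ uncanceledClose (opening A B C) (closing A B C) ↔
      ∀ y ≤ x, height A B C y < height A B C (x + 1) := by
  constructor
  · rintro ⟨hx, hy⟩ y hxy
    have h1 := hy y
    have h2 := h.ncard_Ico hxy
    have h3 := h.height_step x
    rw [excess_of_mem_closing hx] at h3
    omega
  · intro hx
    have h3 := h.height_step x
    have h4 := hx x le_rfl
    have h5 : x ∈ closing A B C := by
      by_contra h5
      rw [excess, if_neg h5] at h3
      split_ifs at h3 <;> omega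
    rw [excess_of_mem_closing h5] at h3
    refine ⟨h5, fun y => ?_⟩
    rcases le_or_gt x y with hy | hy
    · simp [Ico_eq_empty (not_lt.2 hy)]
    · have h6 := h.ncard_Ico hy.le
      have h7 := hx y hy.le
      omega

/-- The leftmost uncancelled opening bracket is the rightmost place of maximal height. As `B` is
antitone, this is the smallest `k` attaining the maximum. -/
theorem isLeast_uncanceledOpen (h : BracketStrands A B C) {k : ℕ} (hk : B k < C k)
    (hlt : ∀ m < k, height A B C (B m) < height A B C (B k))
    (hle : ∀ m, height A B C (B m) ≤ height A B C (B k)) :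
    IsLeast (uncanceledOpen (opening A B C) (closing A B C)) (B k) := by
  constructor
  · rw [h.mem_uncanceledOpen]
    intro y hy
    have hzero := h.height_B_zero
    rcases le_or_gt (B 0) y with hy0 | hy0
    · rw [h.height_top hy0]
      rcases k with _ | k
      · omega
      · have := hlt 0 (by omega)
        have := h.B_le_C 0
        omega
    · obtain ⟨m, h1, h2⟩ := h.exists_mid hy0
      have hm : m < k := by
        by_contra hm
        have := h.B_antitone (not_lt.1 hm)
        omega
      have h3 := h.height_mid m h1 h2.le
      have h4 := h.height_B_succ m
      have h5 := h.B_succ_le_A m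
      have h6 := hlt m hm
      have h7 := h.C_succ_le_B m
      have h8 := h.A_le_B m
      rcases Nat.lt_or_ge (m + 1) k with hm' | hm'
      · have := hlt (m + 1) hm'
        omega
      · obtain rfl : k = m + 1 := by omega
        omega
  · intro x hx
    rw [h.mem_uncanceledOpen] at hx
    by_contra hxk
    have h1 := hx (B k) (by omega)
    obtain ⟨m, hm⟩ := h.exists_height_le x
    have := hle m
    omega

theorem uncanceledOpen_eq_empty (h : BracketStrands A B C) (h0 : C 0 ≤ B 0)
    (hle : ∀ m, height A B C (B m) ≤ height A B C (B 0)) :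
    uncanceledOpen (opening A B C) (closing A B C) = ∅ := by
  rw [eq_empty_iff_forall_notMem]
  -- An uncancelled opening bracket would have height above that far to the right, which is zero,
  -- whereas all heights are at most the value zero at `B 0`.
  intro x hx
  rw [h.mem_uncanceledOpen] at hx
  obtain ⟨m, hm⟩ := h.exists_height_le x
  have h1 := hle m
  have h2 := h.height_B_zero
  have h3 := hx (max (x + 1) (B 0)) (by omega)
  rw [h.height_top (J := max (x + 1) (B 0)) (by omega)] at h3
  omega

/-- Mirror image: the bracket sits immediately before the leftmost place of maximal height, hence
the shift by one and the largest maximising `k`. -/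
theorem isGreatest_uncanceledClose (h : BracketStrands A B C) {k : ℕ}
    (hlt : ∀ m > k, height A B C (B m) < height A B C (B k))
    (hle : ∀ m, height A B C (B m) ≤ height A B C (B k)) :
    IsGreatest (uncanceledClose (opening A B C) (closing A B C)) (B k - 1) := by
  constructor
  · rw [h.mem_uncanceledClose]
    intro y hy
    rw [sub_add_cancel]
    have hy0 : y < B 0 := by
      have := h.B_antitone (Nat.zero_le k)
      omega
    obtain ⟨m, h1, h2⟩ := h.exists_mid hy0
    have hm : k ≤ m := by
      by_contra hm
      have := h.B_antitone (show m + 1 ≤ k by omega)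
      omega
    have h3 := h.height_mid m h1 h2.le
    have h4 := h.height_B_succ m
    have h5 := h.B_succ_le_A m
    have h6 := hlt (m + 1) (by omega)
    have h7 := h.C_succ_le_B m
    have h8 := h.B_le_C (m + 1)
    have h9 := h.A_le_B m
    rcases hm.lt_or_eq with hm' | rfl
    · have := hlt m hm'
      omega
    · omega
  · intro x hx
    rw [h.mem_uncanceledClose] at hx
    by_contra hxk
    have h1 := hx (B k) (by omega)
    obtain ⟨m, hm⟩ := h.exists_height_le (x + 1)
    have := hle m
    omega

/-- Weak records arbitrarily far to the left dominate any given height, so no closing bracket can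
strictly beat everything to its left. -/
theorem uncanceledClose_eq_empty (h : BracketStrands A B C)
    (hfreq : ∃ᶠ m in atTop, ∀ k < m, height A B C (B k) ≤ height A B C (B m)) :
    uncanceledClose (opening A B C) (closing A B C) = ∅ := by
  rw [eq_empty_iff_forall_notMem]
  intro x hx
  rw [h.mem_uncanceledClose] at hx
  obtain ⟨k, hk⟩ := h.exists_height_le (x + 1)
  obtain ⟨r, hr⟩ := h.exists_le x
  obtain ⟨m, hm, hm'⟩ := frequently_atTop.1 hfreq (max (k + 1) r)
  have h1 := hm' k (by omega)
  have h2 := h.B_antitone (show r ≤ m by omega)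
  have h3 := hx (B m) (by omega)
  omega

end BracketStrands

/-! ### Rows of the periodic extension modulo `ℓ`. -/

namespace Abacus

/-- The row in the fundamental domain which is congruent to the row `J` of the periodic
extension. -/
def row (ℓ : ℕ) [NeZero ℓ] (J : ℤ) : Fin ℓ :=
  ⟨(J % ℓ).toNat, by
    have h : (0 : ℤ) < ℓ := by exact_mod_cast NeZero.pos ℓ
    have h1 := Int.emod_nonneg J h.ne'
    have h2 := Int.emod_lt_of_pos J h
    omega⟩

theorem coe_ediv {ℓ : ℕ} (j : Fin ℓ) : ((j : ℕ) : ℤ) / ℓ = 0 :=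
  Int.ediv_eq_zero_of_lt (by omega) (by have := j.2; omega)

variable {ℓ : ℕ} [NeZero ℓ]

theorem cast_pos : (0 : ℤ) < ℓ := by exact_mod_cast NeZero.pos ℓ

theorem coe_row (J : ℤ) : ((row ℓ J : ℕ) : ℤ) = J % ℓ :=
  Int.toNat_of_nonneg (Int.emod_nonneg J cast_pos.ne')

theorem row_add_mul (J t : ℤ) : row ℓ (J + ℓ * t) = row ℓ J := by
  simp [row]

theorem row_coe (j : Fin ℓ) : row ℓ (j : ℕ) = j := by
  apply Fin.ext
  have : ((row ℓ (j : ℕ) : ℕ) : ℤ) = (j : ℕ) := by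
    rw [coe_row, Int.emod_eq_of_lt (by omega) (by have := j.2; omega)]
  exact_mod_cast this

theorem row_eq_row_iff {J J' : ℤ} : row ℓ J = row ℓ J' ↔ ∃ t, J = J' + ℓ * t := by
  constructor
  · intro h
    have h1 : J % ℓ = J' % ℓ := by rw [← coe_row, ← coe_row, h]
    refine ⟨J / ℓ - J' / ℓ, ?_⟩
    have h2 := Int.emod_add_mul_ediv J ℓ
    have h3 := Int.emod_add_mul_ediv J' ℓ
    rw [mul_sub]
    omega
  · rintro ⟨t, rfl⟩
    exact row_add_mul J' t

end Abacus

/-! ### Strands and their determination by residues up to a shift. -/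

open Abacus

/-- A weakly decreasing sequence which drops by `n` over each period of length `ℓ`: the positions
of the beads with a fixed number counted from the right, on all rows of the periodic extension. -/
structure IsStrand (n ℓ : ℕ) (s : ℤ → ℤ) : Prop where
  antitone : Antitone s
  periodic : ∀ J, s (J + ℓ) = s J - n

/-- The first index at which the values of `s` are at most `x`. -/
noncomputable def threshold (s : ℤ → ℤ) (x : ℤ) : ℤ := sInf {J | s J ≤ x}

/-- The multiset of the residues modulo `n` of the values of `s` on one period. -/
def residues (n ℓ : ℕ) (s : ℤ → ℤ) : Multiset (ZMod n) :=
  (Finset.univ : Finset (Fin ℓ)).val.map fun j : Fin ℓ => ((s (j : ℕ) : ℤ) : ZMod n)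

namespace IsStrand

variable {n ℓ : ℕ} {s r : ℤ → ℤ}

theorem add_mul (hs : IsStrand n ℓ s) (J t : ℤ) : s (J + ℓ * t) = s J - n * t := by
  induction t using Int.induction_on with
  | zero => simp
  | succ t ih =>
    have h := hs.periodic (J + ℓ * t)
    rw [mul_add, mul_add, ← add_assoc, mul_one, mul_one, h, ih]; ring
  | pred t ih =>
    have h := hs.periodic (J + ℓ * (-t - 1))
    rw [show J + ℓ * (-t - 1 : ℤ) + ℓ = J + ℓ * -(t : ℤ) by ring, ih] at h
    linarith

theorem shift (hs : IsStrand n ℓ s) (t : ℤ) : IsStrand n ℓ fun J => s (J + t) where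
  antitone _ _ h := hs.antitone (by omega)
  periodic J := by rw [← hs.periodic]; congr 1; ring

theorem exists_le [NeZero n] (hs : IsStrand n ℓ s) (x : ℤ) : ∃ J, s J ≤ x := by
  refine ⟨0 + ℓ * |s 0 - x|, ?_⟩
  rw [hs.add_mul]
  have h1 : (0 : ℤ) < n := cast_pos
  have h2 := le_abs_self (s 0 - x)
  have h3 := abs_nonneg (s 0 - x)
  nlinarith

theorem exists_gt [NeZero n] (hs : IsStrand n ℓ s) (x : ℤ) : ∃ J, x < s J := by
  refine ⟨0 + ℓ * (-(|s 0 - x| + 1)), ?_⟩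
  rw [hs.add_mul]
  have h1 : (0 : ℤ) < n := cast_pos
  have h2 := neg_abs_le (s 0 - x)
  have h3 := abs_nonneg (s 0 - x)
  nlinarith

theorem threshold_le_iff [NeZero n] (hs : IsStrand n ℓ s) {x J : ℤ} : threshold s x ≤ J ↔ s J ≤ x := by
  have hne : {J | s J ≤ x}.Nonempty := hs.exists_le x
  have hbdd : BddBelow {J | s J ≤ x} := by
    obtain ⟨b, hb⟩ := hs.exists_gt x
    refine ⟨b, fun J (hJ : s J ≤ x) => ?_⟩
    by_contra h
    have := hs.antitone (not_le.1 h).le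
    omega
  constructor
  · intro h
    exact (hs.antitone h).trans (Int.csInf_mem hne hbdd)
  · intro h
    exact csInf_le hbdd h

theorem lt_threshold_iff [NeZero n] (hs : IsStrand n ℓ s) {x J : ℤ} : J < threshold s x ↔ x < s J := by
  rw [← not_le, hs.threshold_le_iff, not_le]

theorem threshold_shift [NeZero n] (hs : IsStrand n ℓ s) (t x : ℤ) :
    threshold (fun J => s (J + t)) x = threshold s x - t := by
  apply eq_of_forall_ge_iff
  intro J
  rw [(hs.shift t).threshold_le_iff, ← hs.threshold_le_iff]
  omega

variable [NeZero ℓ]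

theorem eq_row (hs : IsStrand n ℓ s) (J : ℤ) : s J = s (row ℓ J : ℕ) - n * (J / ℓ) := by
  rw [coe_row, ← hs.add_mul, Int.emod_add_mul_ediv]

theorem exists_sub_le (hs : IsStrand n ℓ s) (hr : IsStrand n ℓ r) : ∃ M, ∀ J, r J - s J ≤ M := by
  obtain ⟨M, hM⟩ := (Set.finite_range fun j : Fin ℓ => r (j : ℕ) - s (j : ℕ)).bddAbove
  refine ⟨M, fun J => ?_⟩
  have := hM ⟨row ℓ J, rfl⟩
  rw [hs.eq_row, hr.eq_row]
  dsimp only at this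
  omega

variable [NeZero n]

/-- Each row of the fundamental domain with residue `x` has exactly one periodic translate on which
the strand equals `x`, and by monotonicity these translates fill the interval between two
thresholds. -/
theorem count_residues (hs : IsStrand n ℓ s) (x : ℤ) :
    (Multiset.count (x : ZMod n) (residues n ℓ s) : ℤ) =
      threshold s (x - 1) - threshold s x := by
  have hle : threshold s x ≤ threshold s (x - 1) := by
    rw [hs.threshold_le_iff]
    have : s (threshold s (x - 1)) ≤ x - 1 := hs.threshold_le_iff.1 le_rfl
    omega
  have hmem : ∀ J, J ∈ Finset.Ico (threshold s x) (threshold s (x - 1)) ↔ s J = x := by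
    intro J
    rw [Finset.mem_Ico, hs.threshold_le_iff, hs.lt_threshold_iff]
    omega
  have hcard : Multiset.count (x : ZMod n) (residues n ℓ s) =
      (Finset.Ico (threshold s x) (threshold s (x - 1))).card := by
    rw [residues, Multiset.count_map]
    symm
    refine Finset.card_bij
      (t := Finset.univ.filter fun j : Fin ℓ => (x : ZMod n) = ((s (j : ℕ) : ℤ) : ZMod n))
      (fun J _ => row ℓ J) ?_ ?_ ?_
    · intro J hJ
      rw [hmem, hs.eq_row] at hJ
      simp [← hJ]
    · intro J hJ J' hJ' h
      rw [hmem] at hJ hJ'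
      obtain ⟨t, rfl⟩ := row_eq_row_iff.1 h
      rw [hs.add_mul, hJ'] at hJ
      have : (n : ℤ) ≠ 0 := cast_pos.ne'
      have : t = 0 := by
        have : (n : ℤ) * t = 0 := by omega
        simp_all
      simp [this]
    · intro j hj
      simp only [Finset.mem_filter, Finset.mem_univ, true_and] at hj
      rw [ZMod.intCast_eq_intCast_iff_dvd_sub] at hj
      obtain ⟨t, ht⟩ := hj
      refine ⟨(j : ℕ) + ℓ * t, ?_, ?_⟩
      · rw [hmem, hs.add_mul]; omega
      · rw [row_add_mul, row_coe]
  rw [hcard, Int.card_Ico, Int.toNat_of_nonneg (by omega)]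

theorem residues_shift (hs : IsStrand n ℓ s) (t : ℤ) :
    residues n ℓ (fun J => s (J + t)) = residues n ℓ s := by
  ext a
  obtain ⟨x, rfl⟩ := ZMod.intCast_surjective a
  have h1 := hs.count_residues x
  have h2 := (hs.shift t).count_residues x
  rw [hs.threshold_shift, hs.threshold_shift] at h2
  omega

/-- Equal residues mean equal gaps between successive thresholds, so the thresholds of the two
strands differ by a constant; a strand is recovered from its thresholds. -/
theorem eq_shift_of_residues_eq (hs : IsStrand n ℓ s) (hr : IsStrand n ℓ r)
    (h : residues n ℓ s = residues n ℓ r) : ∃ t, ∀ J, r J = s (J + t) := by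
  have hstep : ∀ x, threshold r (x - 1) - threshold s (x - 1) = threshold r x - threshold s x := by
    intro x
    have h1 := hs.count_residues x
    have h2 := hr.count_residues x
    rw [h] at h1
    omega
  have hconst : ∀ x, threshold r x - threshold s x = threshold r 0 - threshold s 0 := by
    intro x
    induction x using Int.induction_on with
    | zero => rfl
    | succ x ih => rw [← ih, ← hstep, add_sub_cancel_right]
    | pred x ih => rw [← ih, hstep]
  refine ⟨-(threshold r 0 - threshold s 0), fun J => ?_⟩
  apply eq_of_forall_ge_iff
  intro x
  rw [← hr.threshold_le_iff, ← hs.threshold_le_iff]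
  have := hconst x
  omega

/-- Among the strands with given residues there is at most one that lies above a given strand
and cannot be shifted. -/
theorem eq_of_residues_eq {u : ℤ → ℤ} (hs : IsStrand n ℓ s) (hr : IsStrand n ℓ r)
    (h : residues n ℓ s = residues n ℓ r) (hsu : ∀ J, u J < s J) (hru : ∀ J, u J < r J)
    (hs' : ∃ J, s (J + 1) ≤ u J) (hr' : ∃ J, r (J + 1) ≤ u J) : s = r := by
  obtain ⟨t, ht⟩ := hs.eq_shift_of_residues_eq hr h
  rcases lt_trichotomy t 0 with h0 | rfl | h0
  · obtain ⟨J, hJ⟩ := hr'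
    have h1 := hsu J
    have h2 := hs.antitone (show J + 1 + t ≤ J by omega)
    rw [ht] at hJ
    omega
  · funext J
    rw [ht, add_zero]
  · obtain ⟨J, hJ⟩ := hs'
    have h1 := hru J
    have h2 := hs.antitone (show J + 1 ≤ J + t by omega)
    rw [ht] at h1
    omega

theorem exists_residues_eq (m : Sym (ZMod n) ℓ) : ∃ s, IsStrand n ℓ s ∧ residues n ℓ s = m.1 := by
  obtain ⟨a, ha⟩ : ∃ a : Fin ℓ → ZMod n, (Finset.univ : Finset (Fin ℓ)).val.map a = m.1 := by
    obtain ⟨m, hm⟩ := m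
    induction m using Quotient.inductionOn with
    | _ l =>
      obtain rfl : l.length = ℓ := hm
      exact ⟨l.get, by rw [Fin.univ_val_map, List.ofFn_get]; rfl⟩
  -- Sorting representatives of the negatives increasingly makes their negatives, which lie in `(-n,
  -- 0]`, decrease along one period; the range ensures that the drop by `n` at the end of a period
  -- keeps the strand antitone.
  let f : Fin ℓ → ℤ := fun j => (-a j).val
  have hmono : Monotone (f ∘ Tuple.sort f) := Tuple.monotone_sort f
  have hf0 : ∀ j, 0 ≤ f j := fun j => by positivity
  have hfn : ∀ j, f j < n := fun j => Int.ofNat_lt.2 (ZMod.val_lt (-a j))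
  have hℓ : (0 : ℤ) < ℓ := cast_pos
  have hn : (0 : ℤ) < n := cast_pos
  refine ⟨fun J => -f (Tuple.sort f (row ℓ J)) - n * (J / ℓ), ⟨?_, ?_⟩, ?_⟩
  · intro J J' hJ
    have h1 : J / ℓ ≤ J' / ℓ := Int.ediv_le_ediv hℓ hJ
    have h2 := Int.emod_add_mul_ediv J ℓ
    have h3 := Int.emod_add_mul_ediv J' ℓ
    dsimp only
    rcases h1.lt_or_eq with h4 | h4
    · have h5 := hfn (Tuple.sort f (row ℓ J))
      have h6 := hf0 (Tuple.sort f (row ℓ J'))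
      nlinarith
    · have h5 : row ℓ J ≤ row ℓ J' := by
        rw [Fin.le_def]
        zify
        rw [coe_row, coe_row]
        rw [h4] at h2
        omega
      have := hmono h5
      simp only [Function.comp_apply] at this
      rw [h4]
      omega
  · intro J
    have h1 := row_add_mul (ℓ := ℓ) J 1
    rw [mul_one] at h1
    rw [h1, Int.add_ediv_of_dvd_right dvd_rfl, Int.ediv_self hℓ.ne']
    ring
  · rw [residues, ← ha]
    conv_rhs => rw [← Multiset.map_univ_val_equiv (Tuple.sort f), Multiset.map_map]
    apply Multiset.map_congr rfl
    intro j _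
    simp [row_coe, f]

/-- Among the strands with given residues there is one that lies above a given strand and cannot
be shifted. -/
theorem exists_lift {u : ℤ → ℤ} (hu : IsStrand n ℓ u) (m : Sym (ZMod n) ℓ) :
    ∃ s, IsStrand n ℓ s ∧ residues n ℓ s = m.1 ∧ (∀ J, u J < s J) ∧ ∃ J, s (J + 1) ≤ u J := by
  obtain ⟨s, hs, hm⟩ := exists_residues_eq m
  have hn : (0 : ℤ) < n := cast_pos
  have hℓ : (0 : ℤ) < ℓ := cast_pos
  -- Shifting by larger `t` lowers the strand; the largest admissible shift is the one that cannot
  -- be pushed further.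
  obtain ⟨t, ht, htmax⟩ := Int.exists_greatest_of_bdd (P := fun t => ∀ J, u J < s (J + t))
    (by
      obtain ⟨J, hJ⟩ := hs.exists_le (u 0)
      refine ⟨J, fun t ht => ?_⟩
      by_contra h
      have h1 := ht 0
      have h2 := hs.antitone (show J ≤ 0 + t by omega)
      omega)
    (by
      obtain ⟨M, hM⟩ := hs.exists_sub_le hu
      -- Going back `|M| + 1` periods raises `s` by `n * (|M| + 1)`, more than the bound `M` on `u -
      -- s`.
      refine ⟨ℓ * -(|M| + 1), fun J => ?_⟩
      have h1 := hM J
      have h2 := le_abs_self M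
      have h3 := abs_nonneg M
      rw [hs.add_mul]
      nlinarith)
  refine ⟨fun J => s (J + t), hs.shift t, (hs.residues_shift t).trans hm, ht, ?_⟩
  by_contra! h
  have := htmax (t + 1) fun J => by
    have := h J
    rwa [add_right_comm, add_assoc] at this
  omega

end IsStrand

/-! ### Transport of bracket cancellation from the integers to the places. -/

section Brackets

variable {α : Type*} [LinearOrder α] {ι : ℤ → α}

/-- The segments in `uncanceledOpen` may end at a place outside the image of `ι`; such an end can be
replaced by the last image point not beyond it, which exists because the image is unbounded both
ways. -/
theorem image_inter_Ioc (hι : StrictMono ι) (hlow : ∀ y, ∃ J, ι J < y) (hhigh : ∀ y, ∃ J, y < ι J)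
    (x : ℤ) (y : α) : ∃ z, ∀ S : Set ℤ, ι '' S ∩ Ioc (ι x) y = ι '' (S ∩ Ioc x z) := by
  obtain ⟨z, hz, hz'⟩ := Int.exists_greatest_of_bdd (P := fun J => ι J ≤ y)
    (by
      obtain ⟨J, hJ⟩ := hhigh y
      exact ⟨J, fun J' hJ' => (hι.lt_iff_lt.1 (hJ'.trans_lt hJ)).le⟩)
    (by
      obtain ⟨J, hJ⟩ := hlow y
      exact ⟨J, hJ.le⟩)
  refine ⟨z, fun S => ?_⟩
  ext w
  constructor
  · rintro ⟨⟨J, hJ, rfl⟩, h1, h2⟩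
    exact ⟨J, ⟨hJ, hι.lt_iff_lt.1 h1, hz' J h2⟩, rfl⟩
  · rintro ⟨J, ⟨hJ, h1, h2⟩, rfl⟩
    exact ⟨⟨J, hJ, rfl⟩, hι h1, (hι.monotone h2).trans hz⟩

theorem image_inter_Ico (hι : StrictMono ι) (hlow : ∀ y, ∃ J, ι J < y) (hhigh : ∀ y, ∃ J, y < ι J)
    (x : ℤ) (y : α) : ∃ z, ∀ S : Set ℤ, ι '' S ∩ Ico y (ι x) = ι '' (S ∩ Ico z x) := by
  obtain ⟨z, hz, hz'⟩ := Int.exists_least_of_bdd (P := fun J => y ≤ ι J)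
    (by
      obtain ⟨J, hJ⟩ := hlow y
      exact ⟨J, fun J' hJ' => (hι.lt_iff_lt.1 (hJ.trans_le hJ')).le⟩)
    (by
      obtain ⟨J, hJ⟩ := hhigh y
      exact ⟨J, hJ.le⟩)
  refine ⟨z, fun S => ?_⟩
  ext w
  constructor
  · rintro ⟨⟨J, hJ, rfl⟩, h1, h2⟩
    exact ⟨J, ⟨hJ, hz' J h1, hι.lt_iff_lt.1 h2⟩, rfl⟩
  · rintro ⟨J, ⟨hJ, h1, h2⟩, rfl⟩
    exact ⟨⟨J, hJ, rfl⟩, hz.trans (hι.monotone h1), hι h2⟩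

theorem uncanceledOpen_image (hι : StrictMono ι) (hlow : ∀ y, ∃ J, ι J < y)
    (hhigh : ∀ y, ∃ J, y < ι J) (O C : Set ℤ) :
    uncanceledOpen (ι '' O) (ι '' C) = ι '' uncanceledOpen O C := by
  have hIoc : ∀ (S : Set ℤ) x y, ι '' S ∩ Ioc (ι x) (ι y) = ι '' (S ∩ Ioc x y) := by
    intro S x y
    ext w
    constructor
    · rintro ⟨⟨J, hJ, rfl⟩, h1, h2⟩
      exact ⟨J, ⟨hJ, hι.lt_iff_lt.1 h1, hι.le_iff_le.1 h2⟩, rfl⟩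
    · rintro ⟨J, ⟨hJ, h1, h2⟩, rfl⟩
      exact ⟨⟨J, hJ, rfl⟩, hι h1, hι.monotone h2⟩
  ext w
  constructor
  · rintro ⟨⟨x, hx, rfl⟩, h⟩
    refine ⟨x, ⟨hx, fun y => ?_⟩, rfl⟩
    have := h (ι y)
    rwa [hIoc, hIoc, ncard_image_of_injective _ hι.injective,
      ncard_image_of_injective _ hι.injective] at this
  · rintro ⟨x, ⟨hx, h⟩, rfl⟩
    refine ⟨⟨x, hx, rfl⟩, fun y => ?_⟩
    obtain ⟨z, hz⟩ := image_inter_Ioc hι hlow hhigh x y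
    rw [hz, hz, ncard_image_of_injective _ hι.injective, ncard_image_of_injective _ hι.injective]
    exact h z

theorem uncanceledClose_image (hι : StrictMono ι) (hlow : ∀ y, ∃ J, ι J < y)
    (hhigh : ∀ y, ∃ J, y < ι J) (O C : Set ℤ) :
    uncanceledClose (ι '' O) (ι '' C) = ι '' uncanceledClose O C := by
  have hIco : ∀ (S : Set ℤ) x y, ι '' S ∩ Ico (ι x) (ι y) = ι '' (S ∩ Ico x y) := by
    intro S x y
    ext w
    constructor
    · rintro ⟨⟨J, hJ, rfl⟩, h1, h2⟩
      exact ⟨J, ⟨hJ, hι.le_iff_le.1 h1, hι.lt_iff_lt.1 h2⟩, rfl⟩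
    · rintro ⟨J, ⟨hJ, h1, h2⟩, rfl⟩
      exact ⟨⟨J, hJ, rfl⟩, hι.monotone h1, hι h2⟩
  ext w
  constructor
  · rintro ⟨⟨x, hx, rfl⟩, h⟩
    refine ⟨x, ⟨hx, fun y => ?_⟩, rfl⟩
    have := h (ι y)
    rwa [hIco, hIco, ncard_image_of_injective _ hι.injective,
      ncard_image_of_injective _ hι.injective] at this
  · rintro ⟨x, ⟨hx, h⟩, rfl⟩
    refine ⟨⟨x, hx, rfl⟩, fun y => ?_⟩
    obtain ⟨z, hz⟩ := image_inter_Ico hι hlow hhigh x y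
    rw [hz, hz, ncard_image_of_injective _ hι.injective, ncard_image_of_injective _ hι.injective]
    exact h z

end Brackets

/-! ### From the abacus to bracket strands at a single gap. -/

namespace Abacus

theorem toPath_val_eq_map {ℓ : ℕ} (n : ℕ) (ψ : Abacus ℓ) (k : ℕ) : (ψ.toPath n k).1 =
    (Finset.univ : Finset (Fin ℓ)).val.map fun j => (((ψ j).bead k : ℤ) : ZMod n) := rfl

variable {n ℓ : ℕ} [NeZero ℓ] {ψ ψ' ψ₀ : Abacus ℓ}

theorem ext_eq (n : ℕ) (ψ : Abacus ℓ) (J : ℤ) (k : ℕ) :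
    ψ.ext n J k = (ψ (row ℓ J)).bead k - n * (J / ℓ) := rfl

theorem ext_coe (n : ℕ) (ψ : Abacus ℓ) (j : Fin ℓ) (k : ℕ) :
    ψ.ext n (j : ℕ) k = (ψ j).bead k := by
  rw [ext_eq, row_coe, coe_ediv, mul_zero, sub_zero]

theorem ext_add_mul (n : ℕ) (ψ : Abacus ℓ) (J t : ℤ) (k : ℕ) :
    ψ.ext n (J + ℓ * t) k = ψ.ext n J k - n * t := by
  rw [ext_eq, ext_eq, row_add_mul, Int.add_mul_ediv_left _ _ cast_pos.ne']
  ring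

theorem ext_strictAnti (n : ℕ) (ψ : Abacus ℓ) (J : ℤ) : StrictAnti (ψ.ext n J) := by
  intro k m h
  have := (ψ (row ℓ J)).strictAnti h
  rw [ext_eq, ext_eq]
  omega

theorem IsDescending.isStrand (h : ψ.IsDescending n) (k : ℕ) :
    IsStrand n ℓ fun J => ψ.ext n J k where
  antitone := antitone_int_of_succ_le fun J => h J k
  periodic J := by simpa using ext_add_mul n ψ J 1 k

theorem toPath_val (n : ℕ) (ψ : Abacus ℓ) (k : ℕ) :
    (ψ.toPath n k).1 = residues n ℓ fun J => ψ.ext n J k := by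
  simp only [residues, ext_coe]
  rfl

/-- The places of the brackets of a fixed colour, numbered in their order. The brackets of
colour `g` are those which the periodic extension has at the single gap `g`. -/
def place (n ℓ : ℕ) [NeZero ℓ] (g J : ℤ) : Place ℓ := toLex (g + n * (J / ℓ), row ℓ J)

theorem exists_place_eq (g m : ℤ) (j : Fin ℓ) :
    ∃ J : ℤ, place n ℓ g J = toLex (g + n * m, j) := by
  refine ⟨(j : ℕ) + ℓ * m, ?_⟩
  rw [place, row_add_mul, row_coe, Int.add_mul_ediv_left _ _ cast_pos.ne', coe_ediv, zero_add]

/-- Row `J` of the extension is a row of the abacus displaced by `n * (J / ℓ)`, so the gap `g` on it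
is the actual gap `g + n * (J / ℓ)`, again of colour `g`. -/
theorem opens_eq (ψ : Abacus ℓ) (g : ℤ) : ψ.opens (g : ZMod n) =
    place n ℓ g '' {J | (∃ k, ψ.ext n J k = g - 1) ∧ ¬ ∃ k, ψ.ext n J k = g} := by
  have key : ∀ J : ℤ, ((∃ k, ψ.ext n J k = g - 1) ∧ ¬ ∃ k, ψ.ext n J k = g) ↔
      (ψ (row ℓ J)).CanMoveRight (g + n * (J / ℓ)) := by
    intro J
    simp only [BeadRow.CanMoveRight, mem_range, ext_eq, sub_eq_iff_eq_add,
      show g - 1 + n * (J / ℓ) = g + n * (J / ℓ) - 1 by ring]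
  ext p
  constructor
  · rintro ⟨h1, h2⟩
    obtain ⟨m, hm⟩ := (ZMod.intCast_eq_intCast_iff_dvd_sub _ _ _).1 h1.symm
    obtain ⟨J, hJ⟩ := exists_place_eq (n := n) g m (ofLex p).2
    have hp : place n ℓ g J = p := by
      rw [hJ, ← hm]
      simp
    refine ⟨J, (key J).2 ?_, hp⟩
    rw [← hp] at h2
    exact h2
  · rintro ⟨J, hJ, rfl⟩
    exact ⟨by simp [place], (key J).1 hJ⟩

theorem closes_eq (ψ : Abacus ℓ) (g : ℤ) : ψ.closes (g : ZMod n) =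
    place n ℓ g '' {J | (∃ k, ψ.ext n J k = g) ∧ ¬ ∃ k, ψ.ext n J k = g - 1} := by
  have key : ∀ J : ℤ, ((∃ k, ψ.ext n J k = g) ∧ ¬ ∃ k, ψ.ext n J k = g - 1) ↔
      (ψ (row ℓ J)).CanMoveLeft (g + n * (J / ℓ)) := by
    intro J
    simp only [BeadRow.CanMoveLeft, mem_range, ext_eq, sub_eq_iff_eq_add,
      show g - 1 + n * (J / ℓ) = g + n * (J / ℓ) - 1 by ring]
  ext p
  constructor
  · rintro ⟨h1, h2⟩
    obtain ⟨m, hm⟩ := (ZMod.intCast_eq_intCast_iff_dvd_sub _ _ _).1 h1.symm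
    obtain ⟨J, hJ⟩ := exists_place_eq (n := n) g m (ofLex p).2
    have hp : place n ℓ g J = p := by
      rw [hJ, ← hm]
      simp
    refine ⟨J, (key J).2 ?_, hp⟩
    rw [← hp] at h2
    exact h2
  · rintro ⟨J, hJ, rfl⟩
    exact ⟨by simp [place], (key J).1 hJ⟩

section Place

variable [NeZero n]

/-- The quotient of `J` by `ℓ` orders the gaps and the remainder orders the rows within a gap. -/
theorem place_strictMono (g : ℤ) : StrictMono (place n ℓ g) := by
  intro J J' h
  have hn : (0 : ℤ) < n := cast_pos
  have h1 := Int.emod_add_mul_ediv J ℓ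
  have h2 := Int.emod_add_mul_ediv J' ℓ
  rw [place, place, Prod.Lex.toLex_lt_toLex]
  rcases (Int.ediv_le_ediv cast_pos h.le : J / ℓ ≤ J' / ℓ).lt_or_eq with h3 | h3
  · left
    dsimp only
    nlinarith
  · right
    refine ⟨by rw [h3], ?_⟩
    dsimp only
    rw [Fin.lt_def]
    zify
    rw [coe_row, coe_row]
    rw [h3] at h1
    omega

theorem exists_place_lt (g : ℤ) (y : Place ℓ) : ∃ J, place n ℓ g J < y := by
  obtain ⟨J, hJ⟩ := exists_place_eq (n := n) g (-(|g - (ofLex y).1| + 1)) (0 : Fin ℓ)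
  refine ⟨J, ?_⟩
  rw [hJ, Prod.Lex.lt_iff]
  left
  have hn : (0 : ℤ) < n := cast_pos
  have h1 := le_abs_self (g - (ofLex y).1)
  have h2 := abs_nonneg (g - (ofLex y).1)
  simp only [ofLex_toLex]
  nlinarith

theorem exists_lt_place (g : ℤ) (y : Place ℓ) : ∃ J, y < place n ℓ g J := by
  obtain ⟨J, hJ⟩ := exists_place_eq (n := n) g (|g - (ofLex y).1| + 1) (0 : Fin ℓ)
  refine ⟨J, ?_⟩
  rw [hJ, Prod.Lex.lt_iff]
  left
  have hn : (0 : ℤ) < n := cast_pos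
  have h1 := neg_abs_le (g - (ofLex y).1)
  have h2 := abs_nonneg (g - (ofLex y).1)
  simp only [ofLex_toLex]
  nlinarith

end Place

/-- The first row of the periodic extension whose bead number `k` is at most `x`. -/
noncomputable def firstRow (n : ℕ) (ψ : Abacus ℓ) (x : ℤ) (k : ℕ) : ℤ :=
  threshold (fun J => ψ.ext n J k) x

namespace IsDescending

variable [NeZero n]

theorem firstRow_le_iff (h : ψ.IsDescending n) {x J : ℤ} {k : ℕ} :
    ψ.firstRow n x k ≤ J ↔ ψ.ext n J k ≤ x := (h.isStrand k).threshold_le_iff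

theorem lt_firstRow_iff (h : ψ.IsDescending n) {x J : ℤ} {k : ℕ} :
    J < ψ.firstRow n x k ↔ x < ψ.ext n J k := (h.isStrand k).lt_threshold_iff

theorem firstRow_anti (h : ψ.IsDescending n) {x y : ℤ} (hxy : x ≤ y) (k : ℕ) :
    ψ.firstRow n y k ≤ ψ.firstRow n x k := by
  rw [h.firstRow_le_iff]
  exact (h.firstRow_le_iff.1 le_rfl).trans hxy

theorem firstRow_succ_le (h : ψ.IsDescending n) (x : ℤ) (k : ℕ) :
    ψ.firstRow n (x - 1) (k + 1) ≤ ψ.firstRow n x k := by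
  rw [h.firstRow_le_iff]
  have h1 := ext_strictAnti n ψ (ψ.firstRow n x k) (Nat.lt_succ_self k)
  have h2 := h.firstRow_le_iff.1 (le_refl (ψ.firstRow n x k))
  simp only [Nat.succ_eq_add_one] at h1
  omega

theorem count_toPath (h : ψ.IsDescending n) (x : ℤ) (k : ℕ) :
    (Multiset.count (x : ZMod n) (ψ.toPath n k).1 : ℤ) =
      ψ.firstRow n (x - 1) k - ψ.firstRow n x k := by
  rw [toPath_val]
  exact (h.isStrand k).count_residues x

/-- Bead `k` is at `g` on the rows `[A k, B k)` and at `g - 1` on `[B k, C k)`. The interlacing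
conditions hold since bead `k + 1` is strictly to the left of bead `k` on each row. -/
theorem bracketStrands (h : ψ.IsDescending n) (g : ℤ) :
    BracketStrands (ψ.firstRow n g) (ψ.firstRow n (g - 1)) (ψ.firstRow n (g - 2)) where
  A_le_B := h.firstRow_anti (by omega)
  B_le_C := h.firstRow_anti (by omega)
  B_succ_le_A k := h.firstRow_succ_le g k
  C_succ_le_B k := by
    have := h.firstRow_succ_le (g - 1) k
    rwa [sub_sub] at this
  exists_le J := by
    obtain ⟨k, hk⟩ := ((ψ (row ℓ J)).eventually_lt (g - 1 + n * (J / ℓ))).exists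
    refine ⟨k, ?_⟩
    rw [h.firstRow_le_iff, ext_eq]
    omega

theorem opens_eq_image (h : ψ.IsDescending n) (g : ℤ) : ψ.opens (g : ZMod n) =
    place n ℓ g '' BracketStrands.opening (ψ.firstRow n g) (ψ.firstRow n (g - 1))
      (ψ.firstRow n (g - 2)) := by
  rw [opens_eq]
  congr 1
  ext J
  simp only [BracketStrands.opening, mem_ofPred_eq, h.firstRow_le_iff, h.lt_firstRow_iff]
  refine and_congr (exists_congr fun k => ?_) (not_congr (exists_congr fun k => ?_)) <;> omega

theorem closes_eq_image (h : ψ.IsDescending n) (g : ℤ) : ψ.closes (g : ZMod n) =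
    place n ℓ g '' BracketStrands.closing (ψ.firstRow n g) (ψ.firstRow n (g - 1))
      (ψ.firstRow n (g - 2)) := by
  rw [closes_eq]
  congr 1
  ext J
  simp only [BracketStrands.closing, mem_ofPred_eq, h.firstRow_le_iff, h.lt_firstRow_iff]
  refine and_congr (exists_congr fun k => ?_) (not_congr (exists_congr fun k => ?_)) <;> omega

theorem uncanceledOpen_eq (h : ψ.IsDescending n) (g : ℤ) :
    uncanceledOpen (ψ.opens (g : ZMod n)) (ψ.closes (g : ZMod n)) =
      place n ℓ g '' uncanceledOpen
        (BracketStrands.opening (ψ.firstRow n g) (ψ.firstRow n (g - 1)) (ψ.firstRow n (g - 2)))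
        (BracketStrands.closing (ψ.firstRow n g) (ψ.firstRow n (g - 1))
          (ψ.firstRow n (g - 2))) := by
  rw [h.opens_eq_image, h.closes_eq_image, uncanceledOpen_image (place_strictMono g)
    (exists_place_lt g) (exists_lt_place g)]

theorem uncanceledClose_eq (h : ψ.IsDescending n) (g : ℤ) :
    uncanceledClose (ψ.opens (g : ZMod n)) (ψ.closes (g : ZMod n)) =
      place n ℓ g '' uncanceledClose
        (BracketStrands.opening (ψ.firstRow n g) (ψ.firstRow n (g - 1)) (ψ.firstRow n (g - 2)))
        (BracketStrands.closing (ψ.firstRow n g) (ψ.firstRow n (g - 1))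
          (ψ.firstRow n (g - 2))) := by
  rw [h.opens_eq_image, h.closes_eq_image, uncanceledClose_image (place_strictMono g)
    (exists_place_lt g) (exists_lt_place g)]

end IsDescending

/-! ### Moving one bead: effect on the path, descent and tightness. -/

/-- `ψ'` arises from `ψ` by moving the bead number `k` on the row congruent to `J₀` by `c`. -/
def IsMove (n : ℕ) (ψ ψ' : Abacus ℓ) (J₀ : ℤ) (k : ℕ) (c : ℤ) : Prop :=
  ∀ J m, ψ'.ext n J m = ψ.ext n J m + if m = k ∧ row ℓ J = row ℓ J₀ then c else 0

theorem isMove_moveRight {g J₀ : ℤ} {k : ℕ} (hk : ψ.ext n J₀ k = g - 1)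
    (hg : ¬ ∃ m, ψ.ext n J₀ m = g) :
    IsMove n ψ (Function.update ψ (row ℓ J₀)
      ((ψ (row ℓ J₀)).moveRight (g + n * (J₀ / ℓ)))) J₀ k 1 := by
  have hcan : (ψ (row ℓ J₀)).CanMoveRight (g + n * (J₀ / ℓ)) := by
    refine ⟨⟨k, ?_⟩, ?_⟩
    · rw [ext_eq] at hk; omega
    · rintro ⟨m, hm⟩
      exact hg ⟨m, by rw [ext_eq]; omega⟩
  have hinj := (ψ (row ℓ J₀)).strictAnti.injective
  intro J m
  rw [ext_eq, ext_eq]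
  by_cases hJ : row ℓ J = row ℓ J₀
  · rw [hJ, Function.update_self, BeadRow.moveRight, dif_pos hcan]
    dsimp only
    rw [ext_eq] at hk
    by_cases hm : m = k
    · subst hm
      rw [if_pos (by omega), if_pos ⟨rfl, rfl⟩]
      omega
    · rw [if_neg, if_neg (by tauto)]
      · omega
      · intro h
        exact hm (hinj (by omega))
  · rw [Function.update_of_ne hJ, if_neg (by tauto)]
    omega

theorem isMove_moveLeft {g J₀ : ℤ} {k : ℕ} (hk : ψ.ext n J₀ k = g)
    (hg : ¬ ∃ m, ψ.ext n J₀ m = g - 1) :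
    IsMove n ψ (Function.update ψ (row ℓ J₀)
      ((ψ (row ℓ J₀)).moveLeft (g + n * (J₀ / ℓ)))) J₀ k (-1) := by
  have hcan : (ψ (row ℓ J₀)).CanMoveLeft (g + n * (J₀ / ℓ)) := by
    refine ⟨⟨k, ?_⟩, ?_⟩
    · rw [ext_eq] at hk; omega
    · rintro ⟨m, hm⟩
      exact hg ⟨m, by rw [ext_eq]; omega⟩
  have hinj := (ψ (row ℓ J₀)).strictAnti.injective
  intro J m
  rw [ext_eq, ext_eq]
  by_cases hJ : row ℓ J = row ℓ J₀
  · rw [hJ, Function.update_self, BeadRow.moveLeft, dif_pos hcan]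
    dsimp only
    rw [ext_eq] at hk
    by_cases hm : m = k
    · subst hm
      rw [if_pos (by omega), if_pos ⟨rfl, rfl⟩]
      omega
    · rw [if_neg, if_neg (by tauto)]
      · omega
      · intro h
        exact hm (hinj (by omega))
  · rw [Function.update_of_ne hJ, if_neg (by tauto)]
    omega

theorem map_update_univ {α β : Type*} [Fintype α] [DecidableEq α] [DecidableEq β] (f : α → β)
    (a : α) (b : β) : (Finset.univ : Finset α).val.map (Function.update f a b) =
      b ::ₘ ((Finset.univ : Finset α).val.map f).erase (f a) := by
  obtain ⟨s, hs⟩ := Multiset.exists_cons_of_mem (Finset.mem_univ_val a)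
  have ha : a ∉ s := by
    have := (Finset.univ : Finset α).nodup
    rw [hs, Multiset.nodup_cons] at this
    exact this.1
  rw [hs, Multiset.map_cons, Multiset.map_cons, Multiset.erase_cons_head, Function.update_self]
  congr 1
  apply Multiset.map_congr rfl
  intro x hx
  rw [Function.update_of_ne]
  rintro rfl
  exact ha hx

namespace IsMove

variable {J₀ c : ℤ} {k : ℕ}

theorem bead_eq (h : IsMove n ψ ψ' J₀ k c) (j : Fin ℓ) (m : ℕ) :
    (ψ' j).bead m = (ψ j).bead m + if m = k ∧ j = row ℓ J₀ then c else 0 := by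
  have := h (j : ℕ) m
  rwa [ext_coe, ext_coe, row_coe] at this

theorem toPath_of_ne (h : IsMove n ψ ψ' J₀ k c) {m : ℕ} (hm : m ≠ k) :
    ψ'.toPath n m = ψ.toPath n m := by
  apply Subtype.ext
  rw [toPath_val_eq_map, toPath_val_eq_map]
  apply Multiset.map_congr rfl
  intro j _
  rw [h.bead_eq, if_neg (by tauto), add_zero]

theorem toPath_eq_update (h : IsMove n ψ ψ' J₀ k c) :
    ψ'.toPath n = Function.update (ψ.toPath n) k (ψ'.toPath n k) := by
  funext m
  by_cases hm : m = k
  · rw [hm, Function.update_self]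
  · rw [Function.update_of_ne hm, h.toPath_of_ne hm]

theorem toPath_val (h : IsMove n ψ ψ' J₀ k c) : (ψ'.toPath n k).1 =
    (((ψ.ext n J₀ k + c : ℤ) : ZMod n)) ::ₘ
      (ψ.toPath n k).1.erase ((ψ.ext n J₀ k : ℤ) : ZMod n) := by
  have h0 : ((ψ.ext n J₀ k : ℤ) : ZMod n) = (((ψ (row ℓ J₀)).bead k : ℤ) : ZMod n) := by
    rw [ext_eq]; simp
  have h1 := map_update_univ (fun j => (((ψ j).bead k : ℤ) : ZMod n)) (row ℓ J₀)
    ((ψ.ext n J₀ k + c : ℤ) : ZMod n)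
  rw [h0, toPath_val_eq_map, toPath_val_eq_map, ← h1]
  refine Multiset.map_congr rfl fun j _ => ?_
  rw [h.bead_eq]
  by_cases hj : j = row ℓ J₀
  · subst hj
    rw [Function.update_self, if_pos ⟨rfl, rfl⟩, Int.cast_add, Int.cast_add, h0]
  · rw [Function.update_of_ne hj, if_neg (by tauto), add_zero]

theorem mem_toPath (n : ℕ) (ψ : Abacus ℓ) (J : ℤ) (k : ℕ) :
    ((ψ.ext n J k : ℤ) : ZMod n) ∈ (ψ.toPath n k).1 := by
  refine Multiset.mem_map.2 ⟨row ℓ J, Finset.mem_univ_val _, ?_⟩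
  rw [ext_eq]; simp

theorem perfectCrystal_f (h : IsMove n ψ ψ' J₀ k 1) {g : ℤ} (hg : ψ.ext n J₀ k = g - 1) :
    (perfectCrystal n ℓ).f (g : ZMod n) (ψ.toPath n k) = some (ψ'.toPath n k) := by
  have h1 := mem_toPath n ψ J₀ k
  have h2 := h.toPath_val
  rw [hg] at h1 h2
  rw [sub_add_cancel] at h2
  push_cast at h1 h2
  exact perfectCrystal_f_of_mem h1 h2

theorem perfectCrystal_e (h : IsMove n ψ ψ' J₀ k (-1)) {g : ℤ} (hg : ψ.ext n J₀ k = g) :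
    (perfectCrystal n ℓ).e (g : ZMod n) (ψ.toPath n k) = some (ψ'.toPath n k) := by
  have h1 := mem_toPath n ψ J₀ k
  have h2 := h.toPath_val
  rw [hg] at h1 h2
  rw [← sub_eq_add_neg] at h2
  push_cast at h1 h2
  exact perfectCrystal_e_of_mem h1 h2

theorem isCompactification (h : IsMove n ψ ψ' J₀ k c) (hψ : ψ.IsCompactification ψ₀) :
    ψ'.IsCompactification ψ₀ := by
  refine ⟨hψ.1, fun j => ?_⟩
  filter_upwards [hψ.2 j, eventually_gt_atTop k] with m hm hkm
  rw [h.bead_eq, if_neg (by omega), add_zero, hm]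

theorem isDescending_right (h : IsMove n ψ ψ' J₀ k 1) (hψ : ψ.IsDescending n)
    (hlt : ψ.ext n J₀ k < ψ.ext n (J₀ - 1) k) : ψ'.IsDescending n := by
  intro J m
  rw [h, h]
  have h1 := hψ J m
  by_cases hc : m = k ∧ row ℓ (J + 1) = row ℓ J₀
  · obtain ⟨rfl, h2⟩ := hc
    obtain ⟨t, ht⟩ := row_eq_row_iff.1 h2
    have h3 : J = J₀ - 1 + ℓ * t := by omega
    have h4 := ext_add_mul n ψ J₀ t m
    have h5 := ext_add_mul n ψ (J₀ - 1) t m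
    rw [← ht] at h4
    rw [← h3] at h5
    split_ifs <;> omega
  · rw [if_neg hc]
    split_ifs <;> omega

theorem isDescending_left (h : IsMove n ψ ψ' J₀ k (-1)) (hψ : ψ.IsDescending n)
    (hlt : ψ.ext n (J₀ + 1) k < ψ.ext n J₀ k) : ψ'.IsDescending n := by
  intro J m
  rw [h, h]
  have h1 := hψ J m
  by_cases hc : m = k ∧ row ℓ J = row ℓ J₀
  · obtain ⟨rfl, h2⟩ := hc
    obtain ⟨t, ht⟩ := row_eq_row_iff.1 h2
    have h3 : J + 1 = J₀ + 1 + ℓ * t := by omega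
    have h4 := ext_add_mul n ψ J₀ t m
    have h5 := ext_add_mul n ψ (J₀ + 1) t m
    rw [← ht] at h4
    rw [← h3] at h5
    split_ifs <;> omega
  · rw [if_neg hc]
    split_ifs <;> omega

variable [NeZero n]

/-- If the move destroyed the only obstruction to tightening bead `k`, then `C (k + 1) = B k`. The
inequality on interval lengths, supplied by maximality of the height, then forces `B (k + 1) = A k`,
and the rows `A k - 1` and `A k` give a second obstruction, which survives. -/
theorem isTight_right (hn : 2 ≤ n) {g : ℤ} (hψ : ψ.IsDescending n)
    (h : IsMove n ψ ψ' (ψ.firstRow n (g - 1) k) k 1)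
    (hg : ψ.ext n (ψ.firstRow n (g - 1) k) k = g - 1) (ht : ψ.IsTight n)
    (hle : ψ.firstRow n (g - 2) (k + 1) - ψ.firstRow n (g - 1) (k + 1) ≤
      ψ.firstRow n (g - 1) k - ψ.firstRow n g k) : ψ'.IsTight n := by
  intro m hcan
  have h1 := ht m
  simp only [CanTighten, not_forall, not_lt] at h1
  obtain ⟨J, hJ⟩ := h1
  have h2 := hcan J
  rw [h, h] at h2
  -- An old obstruction can vanish only if its left-hand bead is the one moved right.
  have hc : m = k ∧ row ℓ (J + 1) = row ℓ (ψ.firstRow n (g - 1) k) := by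
    by_contra hc
    rw [if_neg hc] at h2
    split_ifs at h2 <;> omega
  obtain ⟨rfl, hrow⟩ := hc
  rw [if_neg (by omega), if_pos ⟨rfl, hrow⟩] at h2
  obtain ⟨t, ht⟩ := row_eq_row_iff.1 hrow
  have hS := hψ.bracketStrands g
  have hBA := hS.B_succ_le_A m
  have hCB := hS.C_succ_le_B m
  set B := ψ.firstRow n (g - 1) m
  have h3 : J = B - 1 + ℓ * t := by omega
  have h4 := ext_add_mul n ψ B t m
  have h5 := ext_add_mul n ψ (B - 1) t (m + 1)
  rw [← ht] at h4
  rw [← h3] at h5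
  have h6 : B - 1 < ψ.firstRow n (g - 2) (m + 1) := hψ.lt_firstRow_iff.2 (by omega)
  have h7 : ψ.firstRow n (g - 1) (m + 1) ≤ B - 1 := hψ.firstRow_le_iff.2 (by omega)
  set A := ψ.firstRow n g m with hA
  have h8 : g - 1 < ψ.ext n (A - 1) (m + 1) := hψ.lt_firstRow_iff.1 (by omega)
  have h9 : ψ.ext n A m ≤ g := hψ.firstRow_le_iff.1 le_rfl
  have h10 : g - 1 < ψ.ext n A m := hψ.lt_firstRow_iff.1 (show A < B by omega)
  have h11 := hcan (A - 1)
  rw [h, h, if_neg (by omega), sub_add_cancel] at h11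
  split_ifs at h11 with hif
  · obtain ⟨u, hu⟩ := row_eq_row_iff.1 hif.2
    have h12 := ext_add_mul n ψ B u m
    rw [← hu] at h12
    -- Bead `m` is at `g` on row `A` and at `g - 1` on row `B`; if the rows were congruent, these
    -- values would differ by a multiple of `n`.
    have h13 : (n : ℤ) ∣ 1 := ⟨-u, by rw [mul_neg]; omega⟩
    have := Int.le_of_dvd one_pos h13
    omega
  · omega

/-- Dual to `isTight_right`: the bead moved left now is the right-hand side of an obstruction for
the preceding bead `m`, so `A m = B k`. The length inequality forces `B m = C k`, and the surviving
obstruction lies at the rows `C k - 1` and `C k`. -/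
theorem isTight_left (hn : 2 ≤ n) {g : ℤ} (hψ : ψ.IsDescending n)
    (h : IsMove n ψ ψ' (ψ.firstRow n (g - 1) k - 1) k (-1))
    (hg : ψ.ext n (ψ.firstRow n (g - 1) k - 1) k = g) (ht : ψ.IsTight n)
    (hle : ∀ m, m + 1 = k → ψ.firstRow n (g - 1) m - ψ.firstRow n g m ≤
      ψ.firstRow n (g - 2) k - ψ.firstRow n (g - 1) k) : ψ'.IsTight n := by
  intro m hcan
  have h1 := ht m
  simp only [CanTighten, not_forall, not_lt] at h1
  obtain ⟨J, hJ⟩ := h1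
  have h2 := hcan J
  rw [h, h] at h2
  have hc : m + 1 = k ∧ row ℓ J = row ℓ (ψ.firstRow n (g - 1) k - 1) := by
    by_contra hc
    rw [if_neg hc] at h2
    split_ifs at h2 <;> omega
  obtain ⟨rfl, hrow⟩ := hc
  rw [if_neg (c := m = m + 1 ∧ _) (by omega), if_pos ⟨rfl, hrow⟩] at h2
  obtain ⟨t, ht⟩ := row_eq_row_iff.1 hrow
  have hS := hψ.bracketStrands g
  have hBA := hS.B_succ_le_A m
  have hCB := hS.C_succ_le_B m
  have hle := hle m rfl
  set B := ψ.firstRow n (g - 1) (m + 1)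
  have h3 : J + 1 = B + ℓ * t := by omega
  have h4 := ext_add_mul n ψ (B - 1) t (m + 1)
  have h5 := ext_add_mul n ψ B t m
  rw [← ht] at h4
  rw [← h3] at h5
  have h6 : B < ψ.firstRow n (g - 1) m := hψ.lt_firstRow_iff.2 (by omega)
  have h7 : ψ.firstRow n g m ≤ B := hψ.firstRow_le_iff.2 (by omega)
  set C := ψ.firstRow n (g - 2) (m + 1) with hC
  have h8 : ψ.ext n C m ≤ g - 1 := hψ.firstRow_le_iff.1 (by omega)
  have h9 : g - 2 < ψ.ext n (C - 1) (m + 1) := hψ.lt_firstRow_iff.1 (by omega)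
  have h10 : ψ.ext n (C - 1) (m + 1) ≤ g - 1 := hψ.firstRow_le_iff.1 (show B ≤ C - 1 by omega)
  have h11 := hcan (C - 1)
  rw [h, h, if_neg (c := m = m + 1 ∧ _) (by omega), sub_add_cancel] at h11
  split_ifs at h11 with hif
  · obtain ⟨u, hu⟩ := row_eq_row_iff.1 hif.2
    have h12 := ext_add_mul n ψ (B - 1) u (m + 1)
    rw [← hu] at h12
    have h13 : (n : ℤ) ∣ 1 := ⟨u, by omega⟩
    have := Int.le_of_dvd one_pos h13
    omega
  · omega

end IsMove

end Abacus

/-! ### Comparison of the operators on configurations and on paths. -/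

theorem Nat.exists_last {P : ℕ → Prop} (h : ∃ k, P k) (h' : ∀ᶠ m in atTop, ¬ P m) :
    ∃ k, P k ∧ ∀ m > k, ¬ P m := by
  classical
  have hex := eventually_atTop.1 h'
  obtain ⟨k, hk⟩ := h
  have hpos : Nat.find hex ≠ 0 := fun h0 => Nat.find_spec hex k (by omega) hk
  obtain ⟨M, hM⟩ := Nat.exists_eq_succ_of_ne_zero hpos
  have hspec : ∀ m > M, ¬ P m := fun m hm => Nat.find_spec hex m (by omega)
  refine ⟨M, ?_, hspec⟩
  by_contra hP
  refine Nat.find_min hex (m := M) (by omega) fun m hm => ?_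
  rcases (show M ≤ m from hm).lt_or_eq with hm | rfl
  · exact hspec m hm
  · exact hP

namespace Abacus

open CrystalOps

variable {n ℓ : ℕ}

theorem crystal_f_of_isLeast {ψ : Abacus ℓ} {i : ZMod n} {p : Place ℓ}
    (h : IsLeast (uncanceledOpen (ψ.opens i) (ψ.closes i)) p) :
    (crystal n ℓ).f i ψ = some (Function.update ψ (ofLex p).2
      ((ψ (ofLex p).2).moveRight (ofLex p).1)) := by
  have hex : ∃ p, IsLeast (uncanceledOpen (ψ.opens i) (ψ.closes i)) p := ⟨p, h⟩
  have hp : hex.choose = p := hex.choose_spec.unique h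
  simp only [crystal]
  rw [dif_pos hex, hp]

theorem crystal_e_of_isGreatest {ψ : Abacus ℓ} {i : ZMod n} {p : Place ℓ}
    (h : IsGreatest (uncanceledClose (ψ.opens i) (ψ.closes i)) p) :
    (crystal n ℓ).e i ψ = some (Function.update ψ (ofLex p).2
      ((ψ (ofLex p).2).moveLeft (ofLex p).1)) := by
  have hex : ∃ p, IsGreatest (uncanceledClose (ψ.opens i) (ψ.closes i)) p := ⟨p, h⟩
  have hp : hex.choose = p := hex.choose_spec.unique h
  simp only [crystal]
  rw [dif_pos hex, hp]

theorem crystal_f_of_empty {ψ : Abacus ℓ} {i : ZMod n}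
    (h : uncanceledOpen (ψ.opens i) (ψ.closes i) = ∅) : (crystal n ℓ).f i ψ = none := by
  simp only [crystal]
  rw [dif_neg]
  rintro ⟨p, hp⟩
  rw [h] at hp
  exact hp.1

theorem crystal_e_of_empty {ψ : Abacus ℓ} {i : ZMod n}
    (h : uncanceledClose (ψ.opens i) (ψ.closes i) = ∅) : (crystal n ℓ).e i ψ = none := by
  simp only [crystal]
  rw [dif_neg]
  rintro ⟨p, hp⟩
  rw [h] at hp
  exact hp.1

theorem count_toPath_succ {ψ : Abacus ℓ} {k : ℕ}
    (h : ∀ j, (ψ j).bead (k + 1) = (ψ j).bead k - 1) (i : ZMod n) :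
    Multiset.count (i - 1) (ψ.toPath n (k + 1)).1 = Multiset.count i (ψ.toPath n k).1 := by
  have h1 : (ψ.toPath n (k + 1)).1 = (ψ.toPath n k).1.map fun a => a - 1 := by
    rw [toPath_val_eq_map, toPath_val_eq_map, Multiset.map_map]
    refine Multiset.map_congr rfl fun j _ => ?_
    rw [h, Function.comp_apply, Int.cast_sub, Int.cast_one]
  rw [h1, Multiset.count_map_eq_count' _ _ (sub_left_injective (b := (1 : ZMod n)))]

/-- The values of `φ` are the letter multiplicities, so they determine a factor, and the ground
state conditions prescribe them recursively. -/
theorem isGroundStatePath_unique (hn : 2 ≤ n) {lam : ZMod n → ℕ} {p q : ℕ → Sym (ZMod n) ℓ}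
    (hp : (perfectCrystal n ℓ).IsGroundStatePath lam p)
    (hq : (perfectCrystal n ℓ).IsGroundStatePath lam q) : p = q := by
  have key : ∀ b b' : Sym (ZMod n) ℓ,
      (∀ i, (perfectCrystal n ℓ).phi i b = (perfectCrystal n ℓ).phi i b') → b = b' := by
    intro b b' h
    apply Subtype.ext
    ext a
    have := h (a + 1)
    rwa [perfectCrystal_phi hn, perfectCrystal_phi hn, add_sub_cancel_right] at this
  funext k
  induction k with
  | zero => exact key _ _ fun i => by rw [hp.1, hq.1]
  | succ k ih => exact key _ _ fun i => by rw [← hp.2, ← hq.2, ih]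

variable {ψ ψ₀ : Abacus ℓ}

theorem IsCompactification.eventually_bead (h : ψ.IsCompactification ψ₀) :
    ∀ᶠ k in atTop, ∀ j, (ψ j).bead k = (ψ₀ j).bead k := by
  rw [eventually_all]
  exact h.2

theorem IsCompactification.eventually_bead_succ (h : ψ.IsCompactification ψ₀) :
    ∀ᶠ k in atTop, ∀ j, (ψ j).bead (k + 1) = (ψ j).bead k - 1 := by
  filter_upwards [h.eventually_bead, (tendsto_add_atTop_nat 1).eventually h.eventually_bead]
    with k h1 h2 j
  rw [h1, h2, h.1]

/-- In the compact tail `φ` of each factor equals `ε` of its right neighbour, which is at most `ε`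
of the whole product to its right; hence `f i` never acts far to the left. -/
theorem IsCompactification.eventually_phi_le (hn : 2 ≤ n) (hc : ψ.IsCompactification ψ₀)
    (i : ZMod n) : ∀ᶠ k in atTop, (perfectCrystal n ℓ).phi i (ψ.toPath n k) ≤
      ((perfectCrystal n ℓ).power k).eps i (trunc (ψ.toPath n) k) := by
  obtain ⟨M, hM⟩ := eventually_atTop.1 hc.eventually_bead_succ
  refine eventually_atTop.2 ⟨M + 1, fun k hk => ?_⟩
  obtain ⟨k, rfl⟩ : ∃ r, k = r + 1 := ⟨k - 1, by omega⟩
  rw [eps_power_succ (perfectCrystal_isLowerNormal hn _).1 (perfectCrystal_phi_e hn _),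
    perfectCrystal_phi hn, count_toPath_succ (hM k (by omega)),
    (perfectCrystal_isLowerNormal hn i).2]
  exact Nat.le_add_right _ _

theorem IsCompact.isGroundStatePath (hn : 2 ≤ n) (hc : ψ₀.IsCompact) :
    (perfectCrystal n ℓ).IsGroundStatePath (ψ₀.weight n) (ψ₀.toPath n) := by
  refine ⟨fun i => ?_, fun k i => ?_⟩
  · rw [perfectCrystal_phi hn, toPath_val_eq_map, Multiset.count_map, weight]
    simp only [eq_comm]
    rfl
  · rw [perfectCrystal_phi hn, (perfectCrystal_isLowerNormal hn i).2,
      count_toPath_succ fun j => hc j k]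

variable [NeZero ℓ]

namespace IsDescending

theorem phi_toPath [NeZero n] (hn : 2 ≤ n) (h : ψ.IsDescending n) (g : ℤ) (k : ℕ) :
    ((perfectCrystal n ℓ).phi (g : ZMod n) (ψ.toPath n k) : ℤ) =
      ψ.firstRow n (g - 2) k - ψ.firstRow n (g - 1) k := by
  have := h.count_toPath (g - 1) k
  rw [sub_sub] at this
  rw [perfectCrystal_phi hn]
  push_cast at this
  exact this

theorem eps_toPath [NeZero n] (hn : 2 ≤ n) (h : ψ.IsDescending n) (g : ℤ) (k : ℕ) :
    ((perfectCrystal n ℓ).eps (g : ZMod n) (ψ.toPath n k) : ℤ) =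
      ψ.firstRow n (g - 1) k - ψ.firstRow n g k := by
  rw [(perfectCrystal_isLowerNormal hn _).2]
  exact h.count_toPath g k

theorem isHeight [NeZero n] (hn : 2 ≤ n) (h : ψ.IsDescending n) (g : ℤ) :
    IsHeight (fun k => (perfectCrystal n ℓ).phi (g : ZMod n) (ψ.toPath n k))
      (fun k => (perfectCrystal n ℓ).eps (g : ZMod n) (ψ.toPath n k))
      (fun k => ((perfectCrystal n ℓ).power k).eps (g : ZMod n) (trunc (ψ.toPath n) k))
      (fun k => BracketStrands.height (ψ.firstRow n g) (ψ.firstRow n (g - 1))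
        (ψ.firstRow n (g - 2)) (ψ.firstRow n (g - 1) k)) where
  zero := eps_power_zero _ _ _
  succ k := eps_power_succ (perfectCrystal_isLowerNormal hn _).1 (perfectCrystal_phi_e hn _) _ k
  height k := by
    rw [(h.bracketStrands g).height_B_succ, h.phi_toPath hn, h.eps_toPath hn]

/-- The factor on which `f i` acts is the last strict record of the heights at the points `B k`,
which is where the leftmost uncancelled opening bracket sits; without strict records both operators
vanish. -/
theorem f_spec [NeZero n] (hn : 2 ≤ n) (h : ψ.IsDescending n) (hc : ψ.IsCompactification ψ₀)
    (i : ZMod n) :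
    ((crystal n ℓ).f i ψ = none ∧ (kyotoCrystal n ℓ).f i (ψ.toPath n) = none) ∨
      ∃ ψ', (crystal n ℓ).f i ψ = some ψ' ∧
        (kyotoCrystal n ℓ).f i (ψ.toPath n) = some (ψ'.toPath n) ∧
        ψ'.IsDescending n ∧ (ψ.IsTight n → ψ'.IsTight n) ∧ ψ'.IsCompactification ψ₀ := by
  obtain ⟨g, rfl⟩ := ZMod.intCast_surjective i
  have hS := h.bracketStrands g
  have hH := h.isHeight hn g
  have hact := actsBy_f (perfectCrystal n ℓ) (g : ZMod n) (ψ.toPath n)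
  have hev := hc.eventually_phi_le hn (g : ZMod n)
  by_cases hex : ∃ k, ((perfectCrystal n ℓ).power k).eps (g : ZMod n) (trunc (ψ.toPath n) k) <
      (perfectCrystal n ℓ).phi (g : ZMod n) (ψ.toPath n k)
  · right
    obtain ⟨k, hk, hlast⟩ := Nat.exists_last hex (hev.mono fun m hm => not_lt.2 hm)
    have hlt : ∀ m < k,
        BracketStrands.height (ψ.firstRow n g) (ψ.firstRow n (g - 1)) (ψ.firstRow n (g - 2))
          (ψ.firstRow n (g - 1) m) <
        BracketStrands.height (ψ.firstRow n g) (ψ.firstRow n (g - 1)) (ψ.firstRow n (g - 2))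
          (ψ.firstRow n (g - 1) k) := by
      intro m hm
      have := hH.sub_le k m hm
      omega
    have hle := hH.le_of_le (k := k) (fun m hm => not_lt.1 (hlast m hm))
      fun m hm => (hlt m hm).le
    have hBC : ψ.firstRow n (g - 1) k < ψ.firstRow n (g - 2) k := by
      have := h.phi_toPath hn g k
      omega
    have hleast := hS.isLeast_uncanceledOpen hBC hlt hle
    have hleast' : IsLeast (uncanceledOpen (ψ.opens (g : ZMod n)) (ψ.closes (g : ZMod n)))
        (place n ℓ g (ψ.firstRow n (g - 1) k)) := by
      rw [h.uncanceledOpen_eq]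
      exact (place_strictMono g).monotone.map_isLeast hleast
    have hmem := hleast.1.1
    have h1 : ψ.ext n (ψ.firstRow n (g - 1) k) k = g - 1 := by
      have h2 := h.firstRow_le_iff.1 (le_refl (ψ.firstRow n (g - 1) k))
      have h3 := h.lt_firstRow_iff.1 hBC
      omega
    have hmove := isMove_moveRight h1 (by
      rintro ⟨m, hm⟩
      refine hmem.2 ⟨m, h.firstRow_le_iff.2 hm.le, h.lt_firstRow_iff.2 (by omega)⟩)
    refine ⟨_, crystal_f_of_isLeast hleast', ?_, ?_, ?_, ?_⟩
    · refine (hact.stable_of_last hk hlast (hmove.perfectCrystal_f h1)).trans ?_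
      exact congrArg some hmove.toPath_eq_update.symm
    · refine hmove.isDescending_right h ?_
      have := h.lt_firstRow_iff.1 (sub_one_lt (ψ.firstRow n (g - 1) k))
      omega
    · intro ht
      refine hmove.isTight_right hn h h1 ht ?_
      -- Comparing the heights at `B (k + 1)` and `B k` gives `φ (k + 1) ≤ ε k`, the length
      -- inequality needed for tightness.
      have := hle (k + 1)
      rw [hS.height_B_succ] at this
      omega
    · exact hmove.isCompactification hc
  · left
    have hall := fun m => not_lt.1 (not_exists.1 hex m)
    refine ⟨crystal_f_of_empty ?_, hact.stable_of_never fun m => not_lt.2 (hall m)⟩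
    rw [h.uncanceledOpen_eq, hS.uncanceledOpen_eq_empty, image_empty]
    · have h1 := hall 0
      rw [eps_power_zero] at h1
      have := h.phi_toPath hn g 0
      omega
    · exact hH.le_of_le (k := 0) (fun m _ => hall m) (by simp)

theorem e_spec [NeZero n] (hn : 2 ≤ n) (h : ψ.IsDescending n) (hc : ψ.IsCompactification ψ₀)
    (i : ZMod n) :
    ((crystal n ℓ).e i ψ = none ∧ (kyotoCrystal n ℓ).e i (ψ.toPath n) = none) ∨
      ∃ ψ', (crystal n ℓ).e i ψ = some ψ' ∧
        (kyotoCrystal n ℓ).e i (ψ.toPath n) = some (ψ'.toPath n) ∧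
        ψ'.IsDescending n ∧ (ψ.IsTight n → ψ'.IsTight n) ∧ ψ'.IsCompactification ψ₀ := by
  obtain ⟨g, rfl⟩ := ZMod.intCast_surjective i
  have hS := h.bracketStrands g
  have hH := h.isHeight hn g
  have hact := actsBy_e (perfectCrystal n ℓ) (g : ZMod n) (ψ.toPath n)
  have hmono : ∀ k, ((perfectCrystal n ℓ).power k).eps (g : ZMod n) (trunc (ψ.toPath n) k) ≤
      (perfectCrystal n ℓ).phi (g : ZMod n) (ψ.toPath n k) → ∀ m < k,
      BracketStrands.height (ψ.firstRow n g) (ψ.firstRow n (g - 1)) (ψ.firstRow n (g - 2))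
        (ψ.firstRow n (g - 1) m) ≤
      BracketStrands.height (ψ.firstRow n g) (ψ.firstRow n (g - 1)) (ψ.firstRow n (g - 2))
        (ψ.firstRow n (g - 1) k) := by
    intro k hk m hm
    have := hH.sub_le k m hm
    omega
  by_cases hfr : ∃ᶠ k in atTop,
      ((perfectCrystal n ℓ).power k).eps (g : ZMod n) (trunc (ψ.toPath n) k) ≤
      (perfectCrystal n ℓ).phi (g : ZMod n) (ψ.toPath n k)
  · left
    refine ⟨crystal_e_of_empty ?_,
      hact.stable_of_frequently hfr (perfectCrystal_e_ne_self hn _)⟩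
    rw [h.uncanceledClose_eq, hS.uncanceledClose_eq_empty (hfr.mono hmono), image_empty]
  · right
    obtain ⟨k, hk, hlast⟩ := Nat.exists_last (P := fun k =>
      ((perfectCrystal n ℓ).power k).eps (g : ZMod n) (trunc (ψ.toPath n) k) ≤
      (perfectCrystal n ℓ).phi (g : ZMod n) (ψ.toPath n k))
      -- Index `0` always qualifies, since the empty product to its right has `ε = 0`; so the only
      -- way for `e i` to vanish is escape to infinity.
      ⟨0, (eps_power_zero _ _ _).trans_le (Nat.zero_le _)⟩ (not_frequently.1 hfr)
    have hlast' := fun m hm => not_le.1 (hlast m hm)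
    have hlt := fun m hm => hH.lt_of_lt hlast' (hmono k hk) (m := m) hm
    have hle := hH.le_of_le (fun m hm => (hlast' m hm).le) (hmono k hk)
    have hAB : ψ.firstRow n g k < ψ.firstRow n (g - 1) k := by
      have h1 := h.eps_toPath hn g k
      have h2 := hH.succ k
      have h3 := hlast' (k + 1) (by omega)
      omega
    have hgr := hS.isGreatest_uncanceledClose hlt hle
    have hgr' : IsGreatest (uncanceledClose (ψ.opens (g : ZMod n)) (ψ.closes (g : ZMod n)))
        (place n ℓ g (ψ.firstRow n (g - 1) k - 1)) := by
      rw [h.uncanceledClose_eq]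
      exact (place_strictMono g).monotone.map_isGreatest hgr
    have hmem := hgr.1.1
    have h1 : ψ.ext n (ψ.firstRow n (g - 1) k - 1) k = g := by
      have h2 := h.firstRow_le_iff.1 (show ψ.firstRow n g k ≤ ψ.firstRow n (g - 1) k - 1 by omega)
      have h3 := h.lt_firstRow_iff.1 (sub_one_lt (ψ.firstRow n (g - 1) k))
      omega
    have hmove := isMove_moveLeft h1 (by
      rintro ⟨m, hm⟩
      refine hmem.2 ⟨m, h.firstRow_le_iff.2 hm.le, h.lt_firstRow_iff.2 (by omega)⟩)
    refine ⟨_, crystal_e_of_isGreatest hgr', ?_, ?_, ?_, ?_⟩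
    · refine (hact.stable_of_last hk hlast (hmove.perfectCrystal_e h1)).trans ?_
      exact congrArg some hmove.toPath_eq_update.symm
    · refine hmove.isDescending_left h ?_
      have := h.firstRow_le_iff.1 (le_refl (ψ.firstRow n (g - 1) k))
      rw [sub_add_cancel]
      omega
    · intro ht
      refine hmove.isTight_left hn h h1 ht ?_
      rintro m rfl
      have := hle m
      rw [hS.height_B_succ] at this
      omega
    · exact hmove.isCompactification hc

end IsDescending

/-! ### Bijectivity -/

/-- Tightening would require the integer bead positions never to drop from one row to the next, yet
they drop by `n` over a period. -/
theorem IsCompact.isTight [NeZero n] (hc : ψ₀.IsCompact) : ψ₀.IsTight n := by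
  have key : ∀ J k, ψ₀.ext n J (k + 1) = ψ₀.ext n J k - 1 := by
    intro J k
    rw [ext_eq, ext_eq, hc]
    ring
  intro k hcan
  have hmono : Monotone fun J => ψ₀.ext n J k := monotone_int_of_le_succ fun J => by
    have := hcan J
    rw [key] at this
    omega
  have h1 : ψ₀.ext n 0 k ≤ ψ₀.ext n (0 + ℓ * 1) k := hmono (by positivity)
  rw [ext_add_mul] at h1
  have : (0 : ℤ) < n := cast_pos
  omega

theorem IsCompact.mem_tightDescending [NeZero n] (hc : ψ₀.IsCompact) (hd : ψ₀.IsDescending n) :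
    ψ₀ ∈ ψ₀.tightDescending n :=
  ⟨hd, hc.isTight, hc, fun _ => Eventually.of_forall fun _ => rfl⟩

theorem toPath_mapsTo (hn : 2 ≤ n) (hc : ψ₀.IsCompact) :
    MapsTo (toPath n) (ψ₀.tightDescending n) (kyotoPaths n ℓ (ψ₀.weight n)) := by
  rintro ψ ⟨-, -, h⟩
  refine ⟨ψ₀.toPath n, hc.isGroundStatePath hn, ?_⟩
  have := h.eventually_bead
  rw [← Nat.cofinite_eq_atTop, eventually_cofinite] at this
  refine this.subset fun k hk hk' => hk (Subtype.ext ?_)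
  rw [toPath_val_eq_map, toPath_val_eq_map]
  exact Multiset.map_congr rfl fun j _ => by rw [hk']

theorem IsTight.exists_le (ht : ψ.IsTight n) (k : ℕ) :
    ∃ J, ψ.ext n (J + 1) k ≤ ψ.ext n J (k + 1) := by
  have := ht k
  simpa only [CanTighten, not_forall, not_lt] using this

theorem toPath_injOn [NeZero n] : InjOn (toPath n) (ψ₀.tightDescending n) := by
  rintro ψ ⟨hd, ht, hc⟩ ψ' ⟨hd', ht', hc'⟩ h
  obtain ⟨K, hK⟩ := eventually_atTop.1 (hc.eventually_bead.and hc'.eventually_bead)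
  -- Downward induction on the bead number from the common tail, with `d` measuring how far below
  -- `K` it has gone.
  have key : ∀ d k, K ≤ k + d → (fun J => ψ.ext n J k) = fun J => ψ'.ext n J k := by
    intro d
    induction d with
    | zero =>
      intro k hk
      funext J
      rw [ext_eq, ext_eq, (hK k hk).1, (hK k hk).2]
    | succ d ih =>
      intro k hk
      have h1 := ih (k + 1) (by omega)
      have h2 : ∀ J, ψ.ext n J (k + 1) = ψ'.ext n J (k + 1) := fun J => congrFun h1 J
      refine (hd.isStrand k).eq_of_residues_eq (hd'.isStrand k) ?_
        (u := fun J => ψ.ext n J (k + 1))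
        (fun J => ext_strictAnti n ψ J (Nat.lt_succ_self k)) (fun J => ?_) (ht.exists_le k) ?_
      · rw [← toPath_val, ← toPath_val, h]
      · rw [h2]
        exact ext_strictAnti n ψ' J (Nat.lt_succ_self k)
      · simp only [h2]
        exact ht'.exists_le k
  funext j
  have hbead : (ψ j).bead = (ψ' j).bead := by
    funext k
    have := congrFun (key K k (by omega)) (j : ℕ)
    rwa [ext_coe, ext_coe] at this
  generalize ψ j = r at hbead
  generalize ψ' j = r' at hbead
  cases r
  cases r'
  congr

theorem exists_strands [NeZero n] (hc : ψ₀.IsCompact) (hd : ψ₀.IsDescending n)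
    (p : ℕ → Sym (ZMod n) ℓ) (K : ℕ) (hK : ∀ k ≥ K, p k = ψ₀.toPath n k) (d : ℕ) :
    ∃ S : ℕ → ℤ → ℤ, (∀ k ≥ K, S k = fun J => ψ₀.ext n J k) ∧
      ∀ k, K ≤ k + d → IsStrand n ℓ (S k) ∧ residues n ℓ (S k) = (p k).1 ∧
        (∀ J, S (k + 1) J < S k J) ∧ ∃ J, S k (J + 1) ≤ S (k + 1) J := by
  induction d with
  | zero =>
    refine ⟨fun k J => ψ₀.ext n J k, fun _ _ => rfl, fun k hk => ⟨hd.isStrand k, ?_,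
      fun J => ext_strictAnti n ψ₀ J (Nat.lt_succ_self k), hc.isTight.exists_le k⟩⟩
    rw [hK k hk, toPath_val]
  | succ d ih =>
    obtain ⟨S, hS, hS'⟩ := ih
    by_cases hdK : K ≤ d
    · exact ⟨S, hS, fun k _ => hS' k (by omega)⟩
    -- The next strand to the right is lifted above the last one constructed; `exists_lift` provides
    -- both strictness of the rows and tightness.
    obtain ⟨s, hs⟩ := (hS' (K - d) (by omega)).1.exists_lift (p (K - d - 1))
    refine ⟨Function.update S (K - d - 1) s, fun k hk => ?_, fun k hk => ?_⟩
    · rw [Function.update_of_ne (by omega), hS k hk]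
    · by_cases hkd : k = K - d - 1
      · subst hkd
        rw [Function.update_self, Function.update_of_ne (by omega),
          show K - d - 1 + 1 = K - d by omega]
        exact hs
      · rw [Function.update_of_ne hkd, Function.update_of_ne (by omega)]
        exact hS' k (by omega)

theorem toPath_surjOn [NeZero n] (hn : 2 ≤ n) (hc : ψ₀.IsCompact) (hd : ψ₀.IsDescending n) :
    SurjOn (toPath n) (ψ₀.tightDescending n) (kyotoPaths n ℓ (ψ₀.weight n)) := by
  rintro p ⟨q, hq, hfin⟩
  obtain rfl := isGroundStatePath_unique hn hq (hc.isGroundStatePath hn)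
  obtain ⟨K, hK⟩ := eventually_atTop.1 (Nat.cofinite_eq_atTop ▸ (eventually_cofinite.2 hfin))
  obtain ⟨S, hS, hS'⟩ := exists_strands hc hd p K hK K
  have hstrand := fun k => hS' k (by omega)
  let ψ : Abacus ℓ := fun j =>
    { bead := fun k => S k (j : ℕ)
      strictAnti := strictAnti_nat_of_succ_lt fun k => (hstrand k).2.2.1 _
      eventually_full := by
        obtain ⟨c, hc⟩ := (ψ₀ j).eventually_full
        refine ⟨c, ?_⟩
        filter_upwards [hc, eventually_ge_atTop K] with k hk hk'
        rw [hS k hk', ← hk]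
        exact ext_coe n ψ₀ j k }
  have hext : ∀ J k, ψ.ext n J k = S k J := by
    intro J k
    rw [(hstrand k).1.eq_row, ext_eq]
  refine ⟨ψ, ⟨fun J k => ?_, fun k hcan => ?_, hc, fun j => ?_⟩, ?_⟩
  · rw [hext, hext]
    exact (hstrand k).1.antitone (by omega)
  · obtain ⟨J, hJ⟩ := (hstrand k).2.2.2
    have := hcan J
    rw [hext, hext] at this
    omega
  · filter_upwards [eventually_ge_atTop K] with k hk
    rw [← ext_coe n ψ, ← ext_coe n ψ₀, hext, hS k hk]
  · funext k
    apply Subtype.ext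
    rw [toPath_val, ← (hstrand k).2.1]
    simp only [hext]

theorem isIsoOn_toPath (hn : 2 ≤ n) (hc : ψ₀.IsCompact) (hd : ψ₀.IsDescending n) :
    (crystal n ℓ).IsIsoOn (kyotoCrystal n ℓ) (ψ₀.tightDescending n)
      (kyotoPaths n ℓ (ψ₀.weight n)) (toPath n) := by
  have : NeZero n := ⟨by omega⟩
  apply IsIsoOn.of_bijOn
  · rintro i ψ ⟨h1, h2, h3⟩ ψ' h
    rcases h1.e_spec hn h3 i with h4 | ⟨ψ'', h4, -, h5, h6, h7⟩
    · rw [h4.1] at h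
      cases h
    · rw [h4, Option.some_inj] at h
      subst h
      exact ⟨h5, h6 h2, h7⟩
  · rintro i ψ ⟨h1, h2, h3⟩ ψ' h
    rcases h1.f_spec hn h3 i with h4 | ⟨ψ'', h4, -, h5, h6, h7⟩
    · rw [h4.1] at h
      cases h
    · rw [h4, Option.some_inj] at h
      subst h
      exact ⟨h5, h6 h2, h7⟩
  · exact ⟨toPath_mapsTo hn hc, toPath_injOn, toPath_surjOn hn hc hd⟩
  · rintro i ψ ⟨h1, -, h3⟩
    rcases h1.e_spec hn h3 i with ⟨h4, h5⟩ | ⟨ψ', h4, h5, -⟩ <;> rw [h4, h5] <;> rfl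
  · rintro i ψ ⟨h1, -, h3⟩
    rcases h1.f_spec hn h3 i with ⟨h4, h5⟩ | ⟨ψ', h4, h5, -⟩ <;> rw [h4, h5] <;> rfl

end Abacus

/-- The map `ψ ↦ ⋯ ⊗ ψ̄^3 ⊗ ψ̄^2 ⊗ ψ̄^1` is a crystal isomorphism from the tight descending
abacus configurations with compactification `ψ₀` onto the Kyoto path model
`P_{n,ℓ}(Λ(ψ₀))`, and it sends `ψ₀` to the (unique) ground state path. -/
theorem mainTheorem6 (n ℓ : ℕ) [NeZero ℓ] (hn : 2 ≤ n) (ψ₀ : Abacus ℓ)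
    (hcompact : ψ₀.IsCompact) (hdesc : ψ₀.IsDescending n) :
    (Abacus.crystal n ℓ).IsIsoOn (kyotoCrystal n ℓ)
        (ψ₀.tightDescending n) (kyotoPaths n ℓ (ψ₀.weight n)) (Abacus.toPath n) ∧
      (∀ ψ ∈ ψ₀.tightDescending n, ∀ i : ZMod n,
        (kyotoCrystal n ℓ).eps i (ψ.toPath n) = (Abacus.crystal n ℓ).eps i ψ ∧
        (kyotoCrystal n ℓ).phi i (ψ.toPath n) = (Abacus.crystal n ℓ).phi i ψ) ∧
      ψ₀ ∈ ψ₀.tightDescending n ∧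
      (∀ g : ℕ → Sym (ZMod n) ℓ,
        (perfectCrystal n ℓ).IsGroundStatePath (ψ₀.weight n) g ↔ g = ψ₀.toPath n) := by
  have : NeZero n := ⟨by omega⟩
  have hiso := Abacus.isIsoOn_toPath hn hcompact hdesc
  have hground := hcompact.isGroundStatePath hn
  exact ⟨hiso, fun ψ hψ i => ⟨hiso.eps_eq i hψ, hiso.phi_eq i hψ⟩,
    hcompact.mem_tightDescending hdesc,
    fun g => ⟨fun hg => Abacus.isGroundStatePath_unique hn hg hground, fun hg => hg ▸ hground⟩⟩
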